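/- Let $(P,\Pi)$ be a (smooth, finite-dimensional) Poisson manifold, i.e. $\Pi$ is a smooth bivector field on $P$ with $[\Pi,\Pi]=0$, and let $\sharp\colon T^*P\to TP$ be contraction with $\Pi$. Let $M\subset P$ be an embedded $m$-dimensional submanifold with conormal bundle $N^*M$ (the annihilator of $TM$ in $T^*P|_M$). Suppose that $M$ is coisotropic, i.e. $\sharp N^*M\subset TM$, and that $\sharp N^*M$ has constant rank equal to the codimension $k:=\dim P-m$ of $M$. Then about every point $x\in M$ there are an open neighbourhood $U\subset P$ and smooth coordinates $(q_1,\dots,q_k,p_1,\dots,p_k,y_1,\dots,y_{m-k})$ on $U$ such that $$M\cap U=\{z\in U : p_1(z)=\dots=p_k(z)=0\}$$ and, on $U$, $$\Pi=\sum_{I=1}^k \partial_{q_I}\wedge\partial_{p_I}+\sum_{i,j=1}^{m-k}\varphi_{ij}(y)\,\partial_{y_i}\wedge\partial_{y_j}$$ for smooth functions $\varphi_{ij}\colon\mathbb R^{m-k}\to\mathbb R$. -/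

import Mathlib

/-!
Canonical pairs are built one at a time, in a slice chart in which `M` is a linear subspace `V`. If
`q_J`, `p_J` are canonical with the `p_J` vanishing on `V`, and `α` is a conormal covector outside
the span of the `dp_J`, extend `α` to a function and make it commute with the pairs already found by
transporting it along their Hamiltonian flows. By coisotropy the field of each `p_J` is tangent
to `V`, so the transported function still vanishes on `V` and can serve as the next momentum. By the
rank condition `♯` is injective on the conormal space, so the Hamiltonian field of this momentum is
nonzero, and straightening that field yields the conjugate position.

After `k` pairs, complete by functions `y_j` that commute with all `q_I` and `p_I`. By the Jacobi
identity the brackets `{y_i, y_j}` commute with the `q_I` and `p_I` too, hence depend on `y` alone;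
as the sum in the normal form runs over ordered pairs, `φ_ij = {y_i, y_j} / 2`.

Smoothness of the flow in time and initial point comes from the implicit function theorem, applied
to the integral equation of the flow on continuous curves `[0, 1] → E`.
-/

open scoped Manifold ContDiff

set_option maxSynthPendingDepth 3

noncomputable section

namespace PoissonGeom

/-- The cotangent space `T*_x P` of a manifold modelled on `ℝⁿ`. -/
abbrev Cotangent (n : ℕ) {P : Type*} [TopologicalSpace P]
    [ChartedSpace (EuclideanSpace ℝ (Fin n)) P] (x : P) : Type :=
  TangentSpace (𝓡 n) x →L[ℝ] ℝ

/-- A smooth bivector field on a manifold `P` modelled on `ℝⁿ`: a smooth family of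
skew-symmetric bilinear forms on the cotangent spaces, i.e. a smooth section of
`Hom(T*P, Hom(T*P, ℝ))` that is skew-symmetric at each point. -/
structure BivectorField (n : ℕ) (P : Type*) [TopologicalSpace P]
    [ChartedSpace (EuclideanSpace ℝ (Fin n)) P] [IsManifold (𝓡 n) ∞ P] where
  /-- the value at a point, as a bilinear form on covectors -/
  toFun (x : P) : Cotangent n x →L[ℝ] Cotangent n x →L[ℝ] ℝ
  skew (x : P) (α β : Cotangent n x) : toFun x α β = - toFun x β α
  smooth : ContMDiff (𝓡 n)
    ((𝓡 n).prod 𝓘(ℝ, (EuclideanSpace ℝ (Fin n) →L[ℝ] ℝ) →L[ℝ]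
      (EuclideanSpace ℝ (Fin n) →L[ℝ] ℝ) →L[ℝ] ℝ)) ∞
    (fun x ↦ Bundle.TotalSpace.mk' ((EuclideanSpace ℝ (Fin n) →L[ℝ] ℝ) →L[ℝ]
      (EuclideanSpace ℝ (Fin n) →L[ℝ] ℝ) →L[ℝ] ℝ)
      (E := fun x : P ↦ Cotangent n x →L[ℝ] Cotangent n x →L[ℝ] ℝ) x (toFun x))

variable {n : ℕ} {P : Type*} [TopologicalSpace P]
  [ChartedSpace (EuclideanSpace ℝ (Fin n)) P] [IsManifold (𝓡 n) ∞ P]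

/-- The bracket `{f, g} = Π(df, dg)` of two functions. -/
def BivectorField.bracket (B : BivectorField n P) (f g : P → ℝ) (x : P) : ℝ :=
  B.toFun x (mvfderiv (𝓡 n) f x) (mvfderiv (𝓡 n) g x)

/-- The Schouten bracket `[Π, Π]`, a trivector field, evaluated on exact 1-forms:
`[Π, Π](df, dg, dh) = 2 ({f, {g, h}} + {g, {h, f}} + {h, {f, g}})` (up to the overall sign, which
depends on conventions). -/
def BivectorField.schoutenSquare (B : BivectorField n P) (f g h : P → ℝ) (x : P) : ℝ :=
  2 * (B.bracket f (B.bracket g h) x + B.bracket g (B.bracket h f) x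
    + B.bracket h (B.bracket f g) x)

/-- `Π` is a Poisson structure: `[Π, Π] = 0`. The trivector `[Π, Π]` is tested on differentials of
locally defined smooth functions, which span the cotangent space at each point. -/
def BivectorField.IsPoisson (B : BivectorField n P) : Prop :=
  ∀ (U : Set P), IsOpen U → ∀ f g h : P → ℝ,
    ContMDiffOn (𝓡 n) 𝓘(ℝ, ℝ) ∞ f U → ContMDiffOn (𝓡 n) 𝓘(ℝ, ℝ) ∞ g U →
    ContMDiffOn (𝓡 n) 𝓘(ℝ, ℝ) ∞ h U → ∀ x ∈ U, B.schoutenSquare f g h x = 0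

instance (x : P) : FiniteDimensional ℝ (TangentSpace (𝓡 n) x) :=
  inferInstanceAs (FiniteDimensional ℝ (EuclideanSpace ℝ (Fin n)))

instance (x : P) : T2Space (TangentSpace (𝓡 n) x) :=
  inferInstanceAs (T2Space (EuclideanSpace ℝ (Fin n)))

/-- The sharp map `♯ : T*_x P → T_x P`, `♯ξ = Π(ξ, ·)`, a vector being identified with the
functional it induces on covectors. -/
def BivectorField.sharp (B : BivectorField n P) (x : P) :
    Cotangent n x →ₗ[ℝ] TangentSpace (𝓡 n) x where
  toFun ξ := (Module.evalEquiv ℝ (TangentSpace (𝓡 n) x)).symm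
    ((B.toFun x ξ).toLinearMap ∘ₗ (LinearMap.toContinuousLinearMap :
      (TangentSpace (𝓡 n) x →ₗ[ℝ] ℝ) ≃ₗ[ℝ] Cotangent n x).toLinearMap)
  map_add' ξ η := by
    rw [← map_add]
    congr 1
    ext ζ
    simp
  map_smul' c ξ := by
    rw [RingHom.id_apply, ← map_smul]
    congr 1
    ext ζ
    simp

/-- The defining property `⟨η, ♯ξ⟩ = Π(ξ, η)` of the sharp map. -/
theorem BivectorField.apply_sharp (B : BivectorField n P) (x : P) (ξ η : Cotangent n x) :
    η (B.sharp x ξ) = B.toFun x ξ η := by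
  have h := Module.apply_evalEquiv_symm_apply (R := ℝ) (M := TangentSpace (𝓡 n) x)
    η.toLinearMap ((B.toFun x ξ).toLinearMap ∘ₗ (LinearMap.toContinuousLinearMap :
      (TangentSpace (𝓡 n) x →ₗ[ℝ] ℝ) ≃ₗ[ℝ] Cotangent n x).toLinearMap)
  exact h

section Submanifold

variable {m : ℕ} {M : Type*} [TopologicalSpace M]
  [ChartedSpace (EuclideanSpace ℝ (Fin m)) M]

/-- The tangent space `T_{i y} M ⊆ T_{i y} P` of a submanifold `i : M → P` at the point `y`. -/
def tangentSub (i : M → P) (y : M) : Submodule ℝ (TangentSpace (𝓡 n) (i y)) :=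
  LinearMap.range (mfderiv (𝓡 m) (𝓡 n) i y).toLinearMap

/-- The fibre at `y` of the conormal bundle `N*M`: the covectors that annihilate `TM`. -/
def conormal (i : M → P) (y : M) : Submodule ℝ (Cotangent n (i y)) where
  carrier := {ξ | ∀ v ∈ tangentSub (m := m) (n := n) i y, ξ v = 0}
  zero_mem' := fun _ _ ↦ rfl
  add_mem' := fun {a b} ha hb v hv ↦ by simp [ha v hv, hb v hv]
  smul_mem' := fun c a ha v hv ↦ by simp [ha v hv]

/-- The fibre at `y` of `♯N*M`. -/
def BivectorField.sharpConormal (B : BivectorField n P) (i : M → P) (y : M) :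
    Submodule ℝ (TangentSpace (𝓡 n) (i y)) :=
  (conormal (m := m) (n := n) i y).map (B.sharp (i y))

/-- The submanifold `i : M → P` is coisotropic: `♯N*M ⊆ TM`. -/
def BivectorField.IsCoisotropic (B : BivectorField n P) (i : M → P) : Prop :=
  ∀ y : M, B.sharpConormal (m := m) i y ≤ tangentSub (m := m) (n := n) i y

end Submanifold

/-- The coordinate space with coordinates `(q_1, …, q_k, p_1, …, p_k, y_1, …, y_l)`, the three
blocks of indices being embedded by `iq`, `ip` and `iy`. -/
abbrev CoordSpace (k l : ℕ) : Type := EuclideanSpace ℝ (Fin k ⊕ Fin k ⊕ Fin l)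

/-- index of the coordinate `q_I` -/
abbrev iq {k l : ℕ} (I : Fin k) : Fin k ⊕ Fin k ⊕ Fin l := Sum.inl I

/-- index of the coordinate `p_I` -/
abbrev ip {k l : ℕ} (I : Fin k) : Fin k ⊕ Fin k ⊕ Fin l := Sum.inr (Sum.inl I)

/-- index of the coordinate `y_j` -/
abbrev iy {k l : ℕ} (j : Fin l) : Fin k ⊕ Fin k ⊕ Fin l := Sum.inr (Sum.inr j)

/-- The `y`-part of a point of the coordinate space. -/
def yPart {k l : ℕ} (z : CoordSpace k l) : EuclideanSpace ℝ (Fin l) :=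
  WithLp.toLp 2 (fun j ↦ z (iy j))

/-- The coordinate vector field `∂_a` of the coordinate system `e`, at the point of `P` with
coordinates `z`. -/
def coordVec {k l : ℕ} (e : OpenPartialHomeomorph P (CoordSpace k l)) (a : Fin k ⊕ Fin k ⊕ Fin l)
    (z : CoordSpace k l) : TangentSpace (𝓡 n) (e.symm z) :=
  mfderiv 𝓘(ℝ, CoordSpace k l) (𝓡 n) e.symm z (EuclideanSpace.single a (1 : ℝ))

/-- The value of the bivector `v ∧ w` on a pair of covectors. -/
def wedge {x : P} (v w : TangentSpace (𝓡 n) x) (α β : Cotangent n x) : ℝ :=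
  α v * β w - α w * β v

end PoissonGeom

end

noncomputable section

namespace PoissonGeom

open Filter Topology Set

section Calculus

variable {E F G : Type*} [NormedAddCommGroup E] [NormedSpace ℝ E]
  [NormedAddCommGroup F] [NormedSpace ℝ F] [NormedAddCommGroup G] [NormedSpace ℝ G]

/-- Smoothness of `f` on some neighbourhood of `x`. This is stronger than `ContDiffAt ℝ ∞ f x`,
which asks for a neighbourhood on which `f` is `C^k` for each finite `k` separately. -/
def SmoothNear (f : E → F) (x : E) : Prop := ∀ᶠ y in 𝓝 x, ContDiffAt ℝ ∞ f y

namespace SmoothNear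

variable {f : E → F} {x : E}

theorem contDiffAt (h : SmoothNear f x) : ContDiffAt ℝ ∞ f x := h.self_of_nhds

theorem differentiableAt (h : SmoothNear f x) : DifferentiableAt ℝ f x :=
  h.contDiffAt.differentiableAt (by simp)

theorem continuousAt (h : SmoothNear f x) : ContinuousAt f x := h.contDiffAt.continuousAt

theorem hasFDerivAt (h : SmoothNear f x) : HasFDerivAt f (fderiv ℝ f x) x :=
  h.differentiableAt.hasFDerivAt

theorem eventually (h : SmoothNear f x) : ∀ᶠ y in 𝓝 x, SmoothNear f y :=
  h.eventually_nhds

theorem of_contDiff (h : ContDiff ℝ ∞ f) : SmoothNear f x :=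
  Eventually.of_forall fun _ ↦ h.contDiffAt

theorem of_contDiffOn {U : Set E} (hU : IsOpen U) (hx : x ∈ U) (h : ContDiffOn ℝ ∞ f U) :
    SmoothNear f x :=
  (hU.mem_nhds hx |> eventually_mem_set.mpr).mono fun _ hy ↦ h.contDiffAt (hU.mem_nhds hy)

theorem comp {g : F → G} (hg : SmoothNear g (f x)) (hf : SmoothNear f x) :
    SmoothNear (fun y ↦ g (f y)) x := by
  filter_upwards [hf, hf.continuousAt.eventually hg] with y hfy hgy using hgy.comp y hfy

theorem prodMk {g : E → G} (hf : SmoothNear f x) (hg : SmoothNear g x) :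
    SmoothNear (fun y ↦ (f y, g y)) x := by
  filter_upwards [hf, hg] with y hfy hgy using hfy.prodMk hgy

theorem fderiv (h : SmoothNear f x) : SmoothNear (fderiv ℝ f) x := by
  filter_upwards [h] with y hy using hy.fderiv_right (by simp)

theorem clm_apply {f : E → F →L[ℝ] G} {g : E → F} (hf : SmoothNear f x) (hg : SmoothNear g x) :
    SmoothNear (fun y ↦ f y (g y)) x := by
  filter_upwards [hf, hg] with y hfy hgy using hfy.clm_apply hgy

theorem add {g : E → F} (hf : SmoothNear f x) (hg : SmoothNear g x) :
    SmoothNear (fun y ↦ f y + g y) x := by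
  filter_upwards [hf, hg] with y hfy hgy using hfy.add hgy

theorem sub {g : E → F} (hf : SmoothNear f x) (hg : SmoothNear g x) :
    SmoothNear (fun y ↦ f y - g y) x := by
  filter_upwards [hf, hg] with y hfy hgy using hfy.sub hgy

theorem neg (hf : SmoothNear f x) : SmoothNear (fun y ↦ - f y) x := by
  filter_upwards [hf] with y hfy using hfy.neg

theorem smul {c : E → ℝ} (hc : SmoothNear c x) (hf : SmoothNear f x) :
    SmoothNear (fun y ↦ c y • f y) x := by
  filter_upwards [hc, hf] with y hcy hfy using hcy.smul hfy

theorem sum {ι : Type*} {s : Finset ι} {f : ι → E → F} (h : ∀ i ∈ s, SmoothNear (f i) x) :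
    SmoothNear (fun y ↦ ∑ i ∈ s, f i y) x := by
  filter_upwards [s.eventually_all.mpr h] with y hy using ContDiffAt.sum hy

theorem const (c : F) : SmoothNear (fun _ : E ↦ c) x := of_contDiff contDiff_const

theorem id : SmoothNear (fun y : E ↦ y) x := of_contDiff contDiff_id

theorem clm (L : E →L[ℝ] F) : SmoothNear L x := of_contDiff L.contDiff

theorem fderiv_comp_apply {g : F → G} (hg : SmoothNear g (f x)) (hf : SmoothNear f x) (v : E) :
    _root_.fderiv ℝ (fun y ↦ g (f y)) x v = _root_.fderiv ℝ g (f x) (_root_.fderiv ℝ f x v) :=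
  DFunLike.congr_fun (_root_.fderiv_comp x hg.differentiableAt hf.differentiableAt) v

theorem exists_contDiff [HasContDiffBump E] (h : SmoothNear f x) :
    ∃ g : E → F, ContDiff ℝ ∞ g ∧ g =ᶠ[𝓝 x] f := by
  obtain ⟨ε, hε, hball⟩ := Metric.eventually_nhds_iff_ball.mp h
  let χ : ContDiffBump x := ⟨ε / 4, ε / 2, by positivity, by linarith⟩
  refine ⟨fun y ↦ χ y • f y, contDiff_iff_contDiffAt.mpr fun y ↦ ?_, ?_⟩
  · rcases lt_or_ge (dist y x) ε with hy | hy
    · exact χ.contDiff.contDiffAt.smul (hball y hy)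
    · have hsupp : y ∉ tsupport χ := by
        rw [χ.tsupport_eq, Metric.mem_closedBall, not_le]
        exact (half_lt_self hε).trans_le hy
      refine contDiffAt_const (c := (0 : F)) |>.congr_of_eventuallyEq ?_
      filter_upwards [notMem_tsupport_iff_eventuallyEq.mp hsupp] with z hz
      simp [hz]
  · filter_upwards [χ.eventuallyEq_one] with z hz
    simp [hz]

theorem exists_openPartialHomeomorph [CompleteSpace E] (h : SmoothNear f x) {L : E ≃L[ℝ] F}
    (hL : HasFDerivAt f (L : E →L[ℝ] F) x) :
    ∃ Φ : OpenPartialHomeomorph E F, ⇑Φ = f ∧ x ∈ Φ.source ∧ ContDiffOn ℝ ∞ f Φ.source ∧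
      ContDiffOn ℝ ∞ Φ.symm Φ.target := by
  let Φ := h.contDiffAt.toOpenPartialHomeomorph f hL (by simp)
  have hinv : ∀ᶠ y in 𝓝 x, _root_.fderiv ℝ f y ∈
      range (ContinuousLinearEquiv.toContinuousLinearMap : (E ≃L[ℝ] F) → E →L[ℝ] F) :=
    h.fderiv.continuousAt.eventually (hL.fderiv ▸ L.nhds)
  obtain ⟨U, hU, hUo, hxU⟩ := eventually_nhds_iff.mp (h.and hinv)
  refine ⟨Φ.restrOpen U hUo, rfl, ⟨h.contDiffAt.mem_toOpenPartialHomeomorph_source hL (by simp),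
    hxU⟩, fun y hy ↦ (hU y hy.2).1.contDiffWithinAt, fun z hz ↦ ?_⟩
  obtain ⟨hsmooth, L', hL'⟩ := hU _ ((Φ.restrOpen U hUo).map_target hz).2
  refine ((Φ.restrOpen U hUo).contDiffAt_symm hz (f₀' := L') ?_ hsmooth).contDiffWithinAt
  rw [hL']
  exact (hsmooth.differentiableAt (by simp)).hasFDerivAt

theorem eventually_isInvertible_fderiv_inr [CompleteSpace F] {Φ : E × F → G} {u : E × F}
    (h : SmoothNear Φ u) (hinv : (_root_.fderiv ℝ Φ u ∘L .inr ℝ E F).IsInvertible) :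
    ∀ᶠ v in 𝓝 u, (_root_.fderiv ℝ Φ v ∘L .inr ℝ E F).IsInvertible := by
  obtain ⟨L, hL⟩ := hinv
  have hnhds : ∀ᶠ A in 𝓝 (_root_.fderiv ℝ Φ u ∘L .inr ℝ E F), A.IsInvertible := by
    rw [← hL]
    exact L.nhds
  exact (h.fderiv.continuousAt.clm_comp continuousAt_const).eventually hnhds

end SmoothNear

theorem exists_smooth_implicit [CompleteSpace E] [CompleteSpace F] [CompleteSpace G]
    {Φ : E × F → G} {u : E × F} (h : SmoothNear Φ u)
    (hinv : (fderiv ℝ Φ u ∘L .inr ℝ E F).IsInvertible) :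
    ∃ ψ : E → F, SmoothNear ψ u.1 ∧ ψ u.1 = u.2 ∧ ∀ᶠ x in 𝓝 u.1, Φ (x, ψ x) = Φ u := by
  let ψ := h.contDiffAt.implicitFunction (by simp) hinv
  have hψu : ψ u.1 = u.2 := h.contDiffAt.implicitFunction_apply_self (by simp) hinv
  have hψ : ∀ᶠ x in 𝓝 u.1, Φ (x, ψ x) = Φ u :=
    h.contDiffAt.eventually_apply_implicitFunction (by simp) hinv
  have hgraph : Tendsto (fun x ↦ (x, ψ x)) (𝓝 u.1) (𝓝 u) := by
    have hc : ContinuousAt ψ u.1 :=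
      (h.contDiffAt.contDiffAt_implicitFunction (by simp) hinv).continuousAt
    simpa only [ContinuousAt, id, hψu] using (continuousAt_id.prodMk hc : ContinuousAt _ u.1)
  refine ⟨ψ, ?_, hψu, hψ⟩
  filter_upwards [hgraph.eventually h,
    hgraph.eventually (h.eventually_isInvertible_fderiv_inr hinv), hψ, hgraph.eventually
      (h.contDiffAt.eventually_apply_eq_iff_implicitFunction (by simp) hinv).eventually_nhds]
    with x hx hx_inv hx_eq huniq
  -- The implicit function based at `(x, ψ x)` is smooth at `x`, and by uniqueness it is `ψ`.
  have hχ := hx.contDiffAt_implicitFunction (by simp) hx_inv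
  have hχx := hx.implicitFunction_apply_self (by simp) hx_inv
  refine hχ.congr_of_eventuallyEq ?_
  have hχgraph : Tendsto (fun y ↦ (y, hx.implicitFunction (by simp) hx_inv y)) (𝓝 x)
      (𝓝 (x, ψ x)) := by
    simpa only [ContinuousAt, id, hχx] using
      (continuousAt_id.prodMk hχ.continuousAt : ContinuousAt _ x)
  filter_upwards [hx.eventually_apply_implicitFunction (by simp) hx_inv,
    hχgraph.eventually huniq] with y hy hy_iff
  exact hy_iff.mp (hy.trans hx_eq)

theorem eq_of_fderiv_sub_eq_zero {f : E → ℝ} {s : Set E} (hs : Convex ℝ s)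
    (hf : ∀ x ∈ s, DifferentiableAt ℝ f x) {x y : E} (hx : x ∈ s) (hy : y ∈ s)
    (h : ∀ z ∈ s, fderiv ℝ f z (y - x) = 0) : f x = f y := by
  obtain ⟨z, hz, hfz⟩ :=
    domain_mvt (fun z hz ↦ (hf z hz).hasFDerivAt.hasFDerivWithinAt) hs hx hy
  rw [h z (hs.segment_subset hx hy hz)] at hfz
  exact (sub_eq_zero.mp hfz).symm

end Calculus

section Superposition

universe u v

variable {K : Type v} [TopologicalSpace K] [CompactSpace K]

/-- Pointwise application of a family of linear maps, as a continuous bilinear map. -/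
def pointwiseApply (K : Type v) [TopologicalSpace K] [CompactSpace K] (E F : Type u)
    [NormedAddCommGroup E] [NormedSpace ℝ E] [NormedAddCommGroup F] [NormedSpace ℝ F] :
    C(K, E →L[ℝ] F) →L[ℝ] C(K, E) →L[ℝ] C(K, F) :=
  LinearMap.mkContinuous₂
    (LinearMap.mk₂ ℝ (fun A v ↦ ⟨fun t ↦ A t (v t), by fun_prop⟩)
      (fun _ _ _ ↦ by ext; simp) (fun _ _ _ ↦ by ext; simp)
      (fun _ _ _ ↦ by ext; simp) (fun _ _ _ ↦ by ext; simp)) 1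
    (fun A v ↦ by
      rw [ContinuousMap.norm_le _ (by positivity)]
      intro t
      rw [one_mul]
      exact (A t).le_of_opNorm_le_of_le (A.norm_coe_le_norm t) (v.norm_coe_le_norm t))

variable {E F : Type u} [NormedAddCommGroup E] [NormedSpace ℝ E] [NormedAddCommGroup F]
  [NormedSpace ℝ F]

theorem hasFDerivAt_superposition {X : C(E, F)} {X' : C(E, E →L[ℝ] F)}
    (h : ∀ x, HasFDerivAt X (X' x) x) (u : C(K, E)) :
    HasFDerivAt (fun u : C(K, E) ↦ X.comp u) (pointwiseApply K E F (X'.comp u)) u := by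
  rw [hasFDerivAt_iff_isLittleO_nhds_zero, Asymptotics.isLittleO_iff]
  intro ε hε
  have hc : IsCompact (range u) := isCompact_range u.continuous
  have hu := hc.uniformContinuousAt_of_continuousAt X' (fun _ _ ↦ X'.continuous.continuousAt)
    (Metric.dist_mem_uniformity hε)
  obtain ⟨δ, hδ, hδu⟩ := Metric.mem_uniformity_dist.mp hu
  filter_upwards [Metric.ball_mem_nhds 0 hδ] with v hv
  rw [mem_ball_zero_iff] at hv
  rw [ContinuousMap.norm_le _ (by positivity)]
  intro t
  have hmvt := (convex_ball (u t) δ).norm_image_sub_le_of_norm_hasFDerivWithin_le'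
    (f := X) (f' := X') (φ := X' (u t)) (C := ε) (x := u t) (y := u t + v t)
    (fun x _ ↦ (h x).hasFDerivWithinAt)
    (fun x hx ↦ by
      rw [← dist_eq_norm, dist_comm]
      exact (hδu (a := u t) (b := x) (by rwa [dist_comm]) (mem_range_self t)).le)
    (Metric.mem_ball_self hδ)
    (by rw [Metric.mem_ball, dist_self_add_left]; exact (v.norm_coe_le_norm t).trans_lt hv)
  simp only [add_sub_cancel_left] at hmvt
  exact hmvt.trans (mul_le_mul_of_nonneg_left (v.norm_coe_le_norm t) hε.le)

theorem contDiff_superposition_nat (n : ℕ) : ∀ {F : Type u} [NormedAddCommGroup F]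
    [NormedSpace ℝ F] (X : C(E, F)), ContDiff ℝ n X →
    ContDiff ℝ n (fun u : C(K, E) ↦ X.comp u) := by
  induction n with
  | zero =>
    intro F _ _ X _
    exact contDiff_zero.mpr (ContinuousMap.continuous_postcomp X)
  | succ n ih =>
    intro F _ _ X hX
    have hX' := contDiff_succ_iff_fderiv.mp (by exact_mod_cast hX : ContDiff ℝ ((n : ℕ∞ω) + 1) X)
    let X' : C(E, E →L[ℝ] F) := ⟨fderiv ℝ X, hX'.2.2.continuous⟩
    have hd := fun u : C(K, E) ↦ hasFDerivAt_superposition (X := X) (X' := X')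
      (fun x ↦ (hX'.1 x).hasFDerivAt) u
    push_cast
    refine contDiff_succ_iff_fderiv.mpr ⟨fun u ↦ (hd u).differentiableAt, by simp, ?_⟩
    rw [show fderiv ℝ (fun u : C(K, E) ↦ X.comp u) =
      fun u ↦ pointwiseApply K E F (X'.comp u) from funext fun u ↦ (hd u).fderiv]
    exact (pointwiseApply K E F).contDiff.comp (ih X' hX'.2.2)

theorem contDiff_superposition (X : C(E, F)) (hX : ContDiff ℝ ∞ X) :
    ContDiff ℝ ∞ (fun u : C(K, E) ↦ X.comp u) :=
  contDiff_infty.mpr fun n ↦ contDiff_superposition_nat n X (contDiff_infty.mp hX n)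

end Superposition

section Primitive

variable {E : Type*} [NormedAddCommGroup E] [NormedSpace ℝ E]

/-- The primitive vanishing at `0`, as an operator on the continuous curves `[0, 1] → E`. A curve is
extended by constants outside `[0, 1]` in order to be integrated. -/
def primitiveCLM (E : Type*) [NormedAddCommGroup E] [NormedSpace ℝ E] :
    C(unitInterval, E) →L[ℝ] C(unitInterval, E) :=
  LinearMap.mkContinuous
    { toFun := fun v ↦ ⟨fun s ↦ ∫ r in (0 : ℝ)..s, v (projIcc 0 1 zero_le_one r),
        (intervalIntegral.continuous_primitive (fun _ _ ↦
          (v.continuous.comp continuous_projIcc).intervalIntegrable _ _) 0).comp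
            continuous_subtype_val⟩
      map_add' := fun v w ↦ by
        ext s
        exact intervalIntegral.integral_add
          ((v.continuous.comp continuous_projIcc).intervalIntegrable _ _)
          ((w.continuous.comp continuous_projIcc).intervalIntegrable _ _)
      map_smul' := fun c v ↦ by
        ext s
        exact intervalIntegral.integral_smul c _ } 1
    (fun v ↦ by
      refine (ContinuousMap.norm_le _ (by positivity)).mpr fun s ↦ ?_
      refine (intervalIntegral.norm_integral_le_of_norm_le_const (C := ‖v‖)
        fun r _ ↦ v.norm_coe_le_norm _).trans ?_
      rw [mul_comm, sub_zero, abs_of_nonneg s.2.1]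
      exact mul_le_mul_of_nonneg_right s.2.2 (norm_nonneg v))

theorem primitiveCLM_apply (v : C(unitInterval, E)) (s : unitInterval) :
    primitiveCLM E v s = ∫ r in (0 : ℝ)..s, v (projIcc 0 1 zero_le_one r) := rfl

variable [CompleteSpace E]

theorem hasDerivAt_integral_projIcc (v : C(unitInterval, E)) (s : ℝ) :
    HasDerivAt (fun s : ℝ ↦ ∫ r in (0 : ℝ)..s, v (projIcc 0 1 zero_le_one r))
      (v (projIcc 0 1 zero_le_one s)) s :=
  ((v.continuous.comp continuous_projIcc).integral_hasStrictDerivAt 0 s).hasDerivAt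

theorem primitiveCLM_eq_sub_of_hasDerivAt {v : C(unitInterval, E)} {f : ℝ → E}
    (h : ∀ r : unitInterval, HasDerivAt f (v r) r) (s : unitInterval) :
    primitiveCLM E v s = f s - f 0 := by
  refine intervalIntegral.integral_eq_sub_of_hasDerivAt (fun r hr ↦ ?_)
    ((v.continuous.comp continuous_projIcc).intervalIntegrable _ _)
  rw [uIcc_of_le s.2.1] at hr
  have hr' : r ∈ unitInterval := ⟨hr.1, hr.2.trans s.2.2⟩
  rw [projIcc_of_mem zero_le_one hr']
  exact h ⟨r, hr'⟩

end Primitive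

section Flow

universe u

variable {E : Type u} [NormedAddCommGroup E] [NormedSpace ℝ E]

/-- The defect of a curve `u` in the integral equation `u(s) = x + t ∫₀ˢ Y(u(r)) dr`, whose solution
is `s ↦ φ(st, x)` for the flow `φ` of the vector field `Y`. The argument is `((t, x), u)`. -/
def flowDefect (Y : C(E, E)) (z : (ℝ × E) × C(unitInterval, E)) : C(unitInterval, E) :=
  z.2 - .const _ z.1.2 - z.1.1 • primitiveCLM E (Y.comp z.2)

theorem contDiff_flowDefect {Y : C(E, E)} (hY : ContDiff ℝ ∞ Y) : ContDiff ℝ ∞ (flowDefect Y) := by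
  have hconst : ContDiff ℝ ∞ fun z : (ℝ × E) × C(unitInterval, E) ↦
      ContinuousMap.const unitInterval z.1.2 :=
    (ContinuousLinearMap.const ℝ unitInterval : E →L[ℝ] _).contDiff.comp
      (contDiff_snd.comp contDiff_fst)
  exact (contDiff_snd.sub hconst).sub ((contDiff_fst.comp contDiff_fst).smul
    ((primitiveCLM E).contDiff.comp ((contDiff_superposition Y hY).comp contDiff_snd)))

theorem fderiv_flowDefect {Y : C(E, E)} {Y' : C(E, E →L[ℝ] E)} (hY : ∀ x, HasFDerivAt Y (Y' x) x)
    (t : ℝ) (x : E) (u : C(unitInterval, E)) (τ : ℝ) (ξ : E) (v : C(unitInterval, E)) :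
    fderiv ℝ (flowDefect Y) ((t, x), u) ((τ, ξ), v) = v - .const _ ξ -
      (t • primitiveCLM E (pointwiseApply _ E E (Y'.comp u) v) +
        τ • primitiveCLM E (Y.comp u)) := by
  have hcurve : HasFDerivAt (fun z : (ℝ × E) × C(unitInterval, E) ↦ primitiveCLM E (Y.comp z.2))
      (primitiveCLM E ∘L pointwiseApply _ E E (Y'.comp u) ∘L .snd ℝ _ _) ((t, x), u) :=
    ((primitiveCLM E).hasFDerivAt.comp u (hasFDerivAt_superposition hY u)).comp
      ((t, x), u) (f := Prod.snd) hasFDerivAt_snd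
  let start : (ℝ × E) × C(unitInterval, E) →L[ℝ] C(unitInterval, E) :=
    ContinuousLinearMap.const ℝ unitInterval ∘L .snd ℝ _ _ ∘L .fst ℝ _ _
  let time : (ℝ × E) × C(unitInterval, E) →L[ℝ] ℝ := .fst ℝ _ _ ∘L .fst ℝ _ _
  exact DFunLike.congr_fun
    ((hasFDerivAt_snd.sub start.hasFDerivAt).sub (time.hasFDerivAt.smul hcurve)).fderiv _

/-- The velocity of `s ↦ φ(st, x)` with respect to `t` is `s • Y(φ(st, x))`. -/
theorem fderiv_flowDefect_velocity_eq_zero [CompleteSpace E] {Y : C(E, E)} {Y' : C(E, E →L[ℝ] E)}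
    (hY : ∀ x, HasFDerivAt Y (Y' x) x) {t : ℝ} {x : E} {u : C(unitInterval, E)}
    (hu : flowDefect Y ((t, x), u) = 0) :
    fderiv ℝ (flowDefect Y) ((t, x), u) ((1, 0), ⟨fun s ↦ (s : ℝ) • Y (u s), by fun_prop⟩) = 0 := by
  let U (s : ℝ) : E := x + t • ∫ r in (0 : ℝ)..s, Y.comp u (projIcc 0 1 zero_le_one r)
  have hU_eq (s : unitInterval) : U s = u s := by
    have hus := DFunLike.congr_fun hu s
    simp only [flowDefect, ContinuousMap.sub_apply, ContinuousMap.const_apply,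
      ContinuousMap.smul_apply, primitiveCLM_apply, ContinuousMap.zero_apply] at hus
    rw [sub_sub, sub_eq_zero] at hus
    exact hus.symm
  have hU (s : unitInterval) : HasDerivAt U (t • Y (u s)) s := by
    simpa only [projIcc_val] using!
      ((hasDerivAt_integral_projIcc (Y.comp u) s).const_smul t).const_add x
  have hYU (s : unitInterval) : HasDerivAt (fun s ↦ s • Y (U s))
      ((s : ℝ) • Y' (u s) (t • Y (u s)) + (1 : ℝ) • Y (u s)) s := by
    have hcomp := (hY (U s)).comp_hasDerivAt (s : ℝ) (hU s)
    simpa only [Function.comp_apply, hU_eq] using! (hasDerivAt_id (s : ℝ)).smul hcomp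
  rw [fderiv_flowDefect hY, one_smul, ← map_smul, ← map_add]
  ext s
  have hprim := primitiveCLM_eq_sub_of_hasDerivAt (v := t • pointwiseApply _ E E (Y'.comp u)
    ⟨fun s ↦ (s : ℝ) • Y (u s), by fun_prop⟩ + Y.comp u) (f := fun s ↦ s • Y (U s))
    (fun r ↦ (hYU r).congr_deriv ?_) s
  · simp only [map_add, map_smul, ContinuousMap.add_apply, zero_smul, sub_zero, hU_eq] at hprim
    simp [← hprim]
  · simp [pointwiseApply, smul_comm t]

/-- Differentiating the integral equation in `t` gives a linear equation with a unique solution. -/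
theorem fderiv_eq_velocity_of_flowDefect_eq_zero [CompleteSpace E] {Y : C(E, E)}
    (hY : ContDiff ℝ ∞ Y) {ψ : ℝ × E → C(unitInterval, E)} {p : ℝ × E} (hψ : SmoothNear ψ p)
    (hψY : ∀ᶠ p in 𝓝 p, flowDefect Y (p, ψ p) = 0)
    (hinv : (fderiv ℝ (flowDefect Y) (p, ψ p) ∘L .inr ℝ _ _).IsInvertible) :
    fderiv ℝ ψ p (1, 0) = ⟨fun s ↦ (s : ℝ) • Y (ψ p s), by fun_prop⟩ := by
  let Y' : C(E, E →L[ℝ] E) := ⟨fderiv ℝ Y, hY.continuous_fderiv (by simp)⟩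
  have hY' (x : E) : HasFDerivAt Y (Y' x) x := (hY.differentiable (by simp) x).hasFDerivAt
  have hvel : fderiv ℝ (flowDefect Y) (p, ψ p) ((1, 0), fderiv ℝ ψ p (1, 0)) = 0 := by
    have hcomp := SmoothNear.fderiv_comp_apply (f := fun p ↦ (p, ψ p))
      (.of_contDiff (contDiff_flowDefect hY)) (SmoothNear.id.prodMk hψ) (1, 0)
    rw [EventuallyEq.fderiv_eq hψY, DifferentiableAt.fderiv_prodMk differentiableAt_fun_id
      hψ.differentiableAt] at hcomp
    simpa using hcomp.symm
  apply hinv.injective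
  rw [← sub_eq_zero, ← map_sub]
  simpa using ((fderiv ℝ (flowDefect Y) (p, ψ p)).map_sub ((1, 0), fderiv ℝ ψ p (1, 0)) _).trans
    (congrArg₂ _ hvel (fderiv_flowDefect_velocity_eq_zero hY' hψY.self_of_nhds))

theorem exists_smooth_flow [FiniteDimensional ℝ E] {X : E → E} {x₀ : E} (hX : SmoothNear X x₀) :
    ∃ φ : ℝ × E → E, SmoothNear φ (0, x₀) ∧ (∀ᶠ x in 𝓝 x₀, φ (0, x) = x) ∧
      ∀ᶠ p in 𝓝 ((0 : ℝ), x₀), fderiv ℝ φ p (1, 0) = X (φ p) := by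
  have : CompleteSpace E := FiniteDimensional.complete ℝ E
  obtain ⟨Y₀, hY₀, hYX⟩ := hX.exists_contDiff
  let Y : C(E, E) := ⟨Y₀, hY₀.continuous⟩
  let Y' : C(E, E →L[ℝ] E) := ⟨fderiv ℝ Y₀, hY₀.continuous_fderiv (by simp)⟩
  have hY (x : E) : HasFDerivAt Y (Y' x) x := (hY₀.differentiable (by simp) x).hasFDerivAt
  let u₀ := (((0 : ℝ), x₀), ContinuousMap.const unitInterval x₀)
  have hD (z) : SmoothNear (flowDefect Y) z := .of_contDiff (contDiff_flowDefect hY₀)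
  have hinv : (fderiv ℝ (flowDefect Y) u₀ ∘L .inr ℝ _ _).IsInvertible := by
    refine ⟨.refl ℝ _, ?_⟩
    ext v : 1
    simp [u₀, fderiv_flowDefect hY]
  obtain ⟨ψ, hψ, hψ0, hψ_eq⟩ := exists_smooth_implicit (hD u₀) hinv
  rw [show flowDefect Y u₀ = 0 by simp [flowDefect, u₀]] at hψ_eq
  let ev : C(unitInterval, E) →L[ℝ] E := ContinuousMap.evalCLM ℝ 1
  have hφ : SmoothNear (fun p ↦ ev (ψ p)) (0, x₀) := (SmoothNear.clm ev).comp hψ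
  have hφ0 : ev (ψ (0, x₀)) = x₀ := congrArg ev hψ0
  refine ⟨fun p ↦ ev (ψ p), hφ, ?_, ?_⟩
  · have hcont : ContinuousAt (fun x : E ↦ ((0 : ℝ), x)) x₀ := by fun_prop
    filter_upwards [hcont.eventually hψ_eq] with x hx
    simp only [flowDefect, zero_smul, sub_zero, sub_eq_zero] at hx
    exact congrArg ev hx
  have hgraph : ContinuousAt (fun p ↦ (p, ψ p)) (0, x₀) := continuousAt_id.prodMk hψ.continuousAt
  rw [ContinuousAt, hψ0] at hgraph
  filter_upwards [hψ.eventually, hψ_eq.eventually_nhds,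
    hgraph.eventually ((hD u₀).eventually_isInvertible_fderiv_inr hinv),
    hφ.continuousAt.eventually (hφ0.symm ▸ hYX)] with p hp hp_eq hp_inv hpX
  rw [SmoothNear.fderiv_comp_apply (.clm ev) hp, ev.fderiv,
    fderiv_eq_velocity_of_flowDefect_eq_zero hY₀ hp hp_eq hp_inv, ← hpX]
  simp [ev, Y]

end Flow

section FlowBox

variable {E F : Type*} [NormedAddCommGroup E] [NormedSpace ℝ E] [NormedAddCommGroup F]
  [NormedSpace ℝ F]

theorem fderiv_apply_fderiv_symm_apply {Φ : OpenPartialHomeomorph E F} {x : E} (hx : x ∈ Φ.source)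
    (hΦ : DifferentiableAt ℝ Φ x) (hΦ' : DifferentiableAt ℝ Φ.symm (Φ x)) (w : F) :
    fderiv ℝ Φ x (fderiv ℝ Φ.symm (Φ x) w) = w := by
  have hΦ₁ : HasFDerivAt Φ (fderiv ℝ Φ x) (Φ.symm (Φ x)) := by
    rw [Φ.left_inv hx]
    exact hΦ.hasFDerivAt
  have hid : HasFDerivAt (Φ ∘ Φ.symm) (.id ℝ F) (Φ x) :=
    (hasFDerivAt_id _).congr_of_eventuallyEq (Φ.eventually_right_inverse (Φ.map_source hx))
  exact DFunLike.congr_fun ((hΦ₁.comp (Φ x) hΦ'.hasFDerivAt).unique hid) w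

theorem exists_levelSet_chart [CompleteSpace E] {h : E → ℝ} {x₀ v : E} (hh : SmoothNear h x₀)
    (hv : fderiv ℝ h x₀ v ≠ 0) :
    ∃ χ : OpenPartialHomeomorph E E, x₀ ∈ χ.source ∧ χ x₀ = 0 ∧ SmoothNear χ.symm 0 ∧
      fderiv ℝ χ.symm 0 = .id ℝ E ∧ ∀ x, fderiv ℝ h x₀ (χ x) = h x - h x₀ := by
  let h' := fderiv ℝ h x₀
  let f (x : E) : E := x - x₀ + ((h' v)⁻¹ * (h x - h x₀ - h' (x - x₀))) • v
  have hsub : SmoothNear (fun x ↦ x - x₀) x₀ := SmoothNear.id.sub (.const x₀)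
  have hf : SmoothNear f x₀ :=
    hsub.add (((SmoothNear.const (h' v)⁻¹).smul ((hh.sub (.const _)).sub
      ((SmoothNear.clm h').comp hsub))).smul (.const v))
  have hf' : HasFDerivAt f (ContinuousLinearEquiv.refl ℝ E : E →L[ℝ] E) x₀ := by
    have hsub' : HasFDerivAt (fun x ↦ x - x₀) (.id ℝ E) x₀ := (hasFDerivAt_id x₀).sub_const x₀
    have := hsub'.add ((((hh.hasFDerivAt.sub_const (h x₀)).sub (h'.hasFDerivAt.comp x₀ hsub')
      ).const_mul (h' v)⁻¹).smul_const v)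
    refine this.congr_fderiv ?_
    ext w
    simp [h']
  obtain ⟨χ, hχ, hx₀, -, hsymm⟩ := hf.exists_openPartialHomeomorph hf'
  have hχ₀ : χ x₀ = 0 := by simp [hχ, f]
  have h0 : (0 : E) ∈ χ.target := hχ₀ ▸ χ.map_source hx₀
  have hsymm₀ : SmoothNear χ.symm 0 := .of_contDiffOn χ.open_target h0 hsymm
  refine ⟨χ, hx₀, hχ₀, hsymm₀, ?_, fun x ↦ ?_⟩
  · ext w
    have := fderiv_apply_fderiv_symm_apply hx₀ (hχ ▸ hf.differentiableAt)
      (hχ₀ ▸ hsymm₀.differentiableAt) w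
    rwa [hχ, hf'.fderiv, ← hχ, hχ₀] at this
  · rw [hχ]
    change h' _ = _
    simp only [f, map_add, map_smul, smul_eq_mul]
    field_simp [show h' v ≠ 0 from hv]
    ring

/-- A chart `Φ` centred at `x₀` in which the vector field `X` is the constant vector field `X x₀`
and the level set of `h` through `x₀` is the hyperplane annihilated by the differential of `h`
at `x₀`. -/
structure IsFlowBox (X : E → E) (h : E → ℝ) (x₀ : E) (Φ : OpenPartialHomeomorph E E) : Prop where
  mem_source : x₀ ∈ Φ.source
  map_self : Φ x₀ = 0
  smooth : SmoothNear Φ x₀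
  smooth_symm : SmoothNear Φ.symm 0
  fderiv_symm_zero : fderiv ℝ Φ.symm 0 = .id ℝ E
  fderiv_symm_field : ∀ᶠ z in 𝓝 0, fderiv ℝ Φ.symm z (X x₀) = X (Φ.symm z)
  level_iff : ∀ᶠ x in 𝓝 x₀, h x = h x₀ ↔ fderiv ℝ h x₀ (Φ x) = 0

theorem fderiv_flow_self {φ : ℝ × E → E} {x₀ : E} (hφ : SmoothNear φ (0, x₀))
    (hφ0 : ∀ᶠ x in 𝓝 x₀, φ (0, x) = x) (w : E) : fderiv ℝ φ (0, x₀) (0, w) = w := by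
  have hcomp : HasFDerivAt (fun x ↦ φ (0, x)) (fderiv ℝ φ (0, x₀) ∘L .inr ℝ ℝ E) x₀ :=
    HasFDerivAt.comp x₀ hφ.hasFDerivAt (hasFDerivAt_prodMk_right _ _)
  exact DFunLike.congr_fun (hcomp.unique ((hasFDerivAt_id x₀).congr_of_eventuallyEq hφ0)) w

/-- `Γ` flows along `X` for the time `ℓ z`, starting on the hypersurface `σ '' {ℓ = 0}`. -/
theorem exists_flow_parametrization [FiniteDimensional ℝ E] {X σ : E → E} {x₀ : E}
    {ℓ : E →L[ℝ] ℝ} (hX : SmoothNear X x₀) (hℓ : ℓ (X x₀) = 1) (hσ : SmoothNear σ 0)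
    (hσ0 : σ 0 = x₀) (hσ' : fderiv ℝ σ 0 = .id ℝ E) :
    ∃ Γ : E → E, SmoothNear Γ 0 ∧ Γ 0 = x₀ ∧ fderiv ℝ Γ 0 = .id ℝ E ∧
      (∀ᶠ z in 𝓝 0, fderiv ℝ Γ z (X x₀) = X (Γ z)) ∧ ∀ᶠ z in 𝓝 0, ℓ z = 0 → Γ z = σ z := by
  obtain ⟨φ, hφ, hφ0, hφX⟩ := exists_smooth_flow hX
  let π : E →L[ℝ] E := .id ℝ E - ℓ.smulRight (X x₀)
  let γ (z : E) : ℝ × E := (ℓ z, σ (π z))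
  have hσπ : SmoothNear (fun z ↦ σ (π z)) 0 :=
    SmoothNear.comp (by rwa [map_zero]) (SmoothNear.clm π)
  have hγ : SmoothNear γ 0 := (SmoothNear.clm ℓ).prodMk hσπ
  have hγ0 : γ 0 = (0, x₀) := by simp [γ, hσ0]
  have hπ : Tendsto π (𝓝 0) (𝓝 0) := by simpa only [map_zero] using π.continuous.tendsto 0
  have hγ_lim : Tendsto γ (𝓝 0) (𝓝 (0, x₀)) := hγ0 ▸ hγ.continuousAt.tendsto
  have hγ' {z : E} (hz : SmoothNear σ (π z)) (w : E) :
      fderiv ℝ γ z w = (ℓ w, fderiv ℝ σ (π z) (π w)) := by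
    rw [DifferentiableAt.fderiv_prodMk ℓ.differentiableAt (hz.comp (.clm π)).differentiableAt,
      ContinuousLinearMap.prod_apply, hz.fderiv_comp_apply (.clm π), π.fderiv, ℓ.fderiv]
  refine ⟨fun z ↦ φ (γ z), SmoothNear.comp (by rwa [hγ0]) hγ,
    (congrArg φ hγ0).trans hφ0.self_of_nhds, ?_, ?_, ?_⟩
  · ext w
    have hw : ((ℓ w, π w) : ℝ × E) = ℓ w • (1, 0) + (0, π w) := by simp
    rw [SmoothNear.fderiv_comp_apply (by rwa [hγ0]) hγ, hγ' (by rwa [map_zero]), map_zero, hσ',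
      hγ0, ContinuousLinearMap.id_apply, hw, map_add, map_smul, hφX.self_of_nhds,
      fderiv_flow_self hφ hφ0, hφ0.self_of_nhds]
    simp [π]
  · filter_upwards [hγ.eventually, hπ.eventually hσ.eventually, hγ_lim.eventually hφX,
      hγ_lim.eventually hφ.eventually] with z hγz hσz hφz hφs
    have hπX : π (X x₀) = 0 := by simp [π, hℓ]
    rw [hφs.fderiv_comp_apply hγz, hγ' hσz, hπX, hℓ, map_zero, hφz]
  · filter_upwards [hσ.continuousAt.eventually (hσ0.symm ▸ hφ0)] with z hz hℓz
    have hπz : π z = z := by simp [π, hℓz]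
    simp only [γ, hπz, hℓz, hz]

theorem exists_isFlowBox [FiniteDimensional ℝ E] {X : E → E} {h : E → ℝ} {x₀ : E}
    (hX : SmoothNear X x₀) (hh : SmoothNear h x₀) (hne : fderiv ℝ h x₀ (X x₀) ≠ 0) :
    ∃ Φ, IsFlowBox X h x₀ Φ := by
  have : CompleteSpace E := FiniteDimensional.complete ℝ E
  obtain ⟨χ, hx₀, hχ₀, hχ, hχ', hχh⟩ := exists_levelSet_chart hh hne
  have hχs : χ.symm 0 = x₀ := by rw [← hχ₀, χ.left_inv hx₀]
  obtain ⟨Γ, hΓ, hΓ0, hΓ', hΓX, hΓχ⟩ := exists_flow_parametrization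
    (ℓ := (fderiv ℝ h x₀ (X x₀))⁻¹ • fderiv ℝ h x₀) hX (inv_mul_cancel₀ hne) hχ hχs hχ'
  obtain ⟨Ψ, hΨ, h0, -, hΨs'⟩ := hΓ.exists_openPartialHomeomorph
    (L := .refl ℝ E) (hΓ.hasFDerivAt.congr_fderiv hΓ')
  have hΨ0 : Ψ 0 = x₀ := by rw [hΨ, hΓ0]
  have hΨx₀ : Ψ.symm x₀ = 0 := by rw [← hΨ0, Ψ.left_inv h0]
  have hx₀Ψ : x₀ ∈ Ψ.target := hΨ0 ▸ Ψ.map_source h0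
  have hΨsmooth : SmoothNear Ψ.symm x₀ := .of_contDiffOn Ψ.open_target hx₀Ψ hΨs'
  refine ⟨Ψ.symm, hx₀Ψ, hΨx₀, hΨsmooth, ?_, ?_, ?_, ?_⟩
  · simpa only [Ψ.symm_symm, hΨ] using hΓ
  · simpa only [Ψ.symm_symm, hΨ] using hΓ'
  · simpa only [Ψ.symm_symm, hΨ] using hΓX
  have hΓχ' : ∀ᶠ z in 𝓝 0, z ∈ Ψ.source ∧ z ∈ χ.target ∧
      (fderiv ℝ h x₀ z = 0 → Ψ z = χ.symm z) := by
    filter_upwards [hΓχ, Ψ.open_source.mem_nhds h0,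
      χ.open_target.mem_nhds (hχ₀ ▸ χ.map_source hx₀)] with z hz hzΨ hzχ
    exact ⟨hzΨ, hzχ, fun h0 ↦ by rw [hΨ]; exact hz (by simp [h0])⟩
  filter_upwards [hΨsmooth.continuousAt.eventually (hΨx₀.symm ▸ hΓχ'),
    (χ.continuousAt hx₀).eventually (hχ₀.symm ▸ hΓχ'), χ.open_source.mem_nhds hx₀,
    Ψ.open_target.mem_nhds hx₀Ψ] with x hxΨ hxχ hx hx'
  refine ⟨fun hxh ↦ ?_, fun hz ↦ ?_⟩
  · have hz : fderiv ℝ h x₀ (χ x) = 0 := by rw [hχh, hxh, sub_self]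
    have := hxχ.2.2 hz
    rw [χ.left_inv hx] at this
    rwa [← this, Ψ.left_inv hxχ.1]
  · have := hxΨ.2.2 hz
    rw [Ψ.right_inv hx'] at this
    rw [← sub_eq_zero, ← hχh, this, χ.right_inv hxΨ.2.1, hz]

namespace IsFlowBox

variable {X : E → E} {h : E → ℝ} {x₀ : E} {Φ : OpenPartialHomeomorph E E}

theorem symm_zero (H : IsFlowBox X h x₀ Φ) : Φ.symm 0 = x₀ := by
  rw [← H.map_self, Φ.left_inv H.mem_source]

theorem tendsto (H : IsFlowBox X h x₀ Φ) : Tendsto Φ (𝓝 x₀) (𝓝 0) := by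
  simpa only [H.map_self] using H.smooth.continuousAt.tendsto

theorem tendsto_symm (H : IsFlowBox X h x₀ Φ) : Tendsto Φ.symm (𝓝 0) (𝓝 x₀) := by
  simpa only [H.symm_zero] using H.smooth_symm.continuousAt.tendsto

theorem eventually_symm_apply (H : IsFlowBox X h x₀ Φ) : ∀ᶠ x in 𝓝 x₀, Φ.symm (Φ x) = x :=
  Φ.eventually_left_inverse H.mem_source

theorem fderiv_self (H : IsFlowBox X h x₀ Φ) : fderiv ℝ Φ x₀ = .id ℝ E := by
  ext w
  have := fderiv_apply_fderiv_symm_apply H.mem_source H.smooth.differentiableAt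
    (H.map_self ▸ H.smooth_symm.differentiableAt) w
  rwa [H.map_self, H.fderiv_symm_zero] at this

theorem fderiv_field (H : IsFlowBox X h x₀ Φ) : ∀ᶠ x in 𝓝 x₀, fderiv ℝ Φ x (X x) = X x₀ := by
  filter_upwards [Φ.open_source.mem_nhds H.mem_source, H.smooth.eventually,
    H.tendsto.eventually H.smooth_symm.eventually, H.tendsto.eventually H.fderiv_symm_field]
    with x hx hs hs' hX
  have := fderiv_apply_fderiv_symm_apply hx hs.differentiableAt hs'.differentiableAt (X x₀)
  rwa [hX, Φ.left_inv hx] at this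

end IsFlowBox

section FirstIntegral

variable [FiniteDimensional ℝ E] {X : E → E} {h : E → ℝ} {x₀ : E}

theorem exists_time_function (hX : SmoothNear X x₀) (hh : SmoothNear h x₀)
    (hne : fderiv ℝ h x₀ (X x₀) ≠ 0) :
    ∃ τ : E → ℝ, SmoothNear τ x₀ ∧ (∀ᶠ x in 𝓝 x₀, fderiv ℝ τ x (X x) = 1) ∧
      ∀ᶠ x in 𝓝 x₀, h x = h x₀ → τ x = 0 := by
  obtain ⟨Φ, hΦ⟩ := exists_isFlowBox hX hh hne
  let ℓ : E →L[ℝ] ℝ := (fderiv ℝ h x₀ (X x₀))⁻¹ • fderiv ℝ h x₀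
  refine ⟨fun x ↦ ℓ (Φ x), (SmoothNear.clm ℓ).comp hΦ.smooth, ?_, ?_⟩
  · filter_upwards [hΦ.fderiv_field, hΦ.smooth.eventually] with x hx hs
    rw [SmoothNear.fderiv_comp_apply (.clm ℓ) hs, ℓ.fderiv, hx]
    exact inv_mul_cancel₀ hne
  · filter_upwards [hΦ.level_iff] with x hx hxh
    simp [ℓ, hx.mp hxh]

theorem exists_first_integral (hX : SmoothNear X x₀) (hh : SmoothNear h x₀)
    (hne : fderiv ℝ h x₀ (X x₀) ≠ 0) {f : E → ℝ} (hf : SmoothNear f x₀) :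
    ∃ F : E → ℝ, SmoothNear F x₀ ∧ (∀ᶠ x in 𝓝 x₀, fderiv ℝ F x (X x) = 0) ∧
      (∀ᶠ x in 𝓝 x₀, h x = h x₀ → F x = f x) ∧
      ∃ c : ℝ, fderiv ℝ F x₀ = fderiv ℝ f x₀ + c • fderiv ℝ h x₀ := by
  obtain ⟨Φ, hΦ⟩ := exists_isFlowBox hX hh hne
  let ℓ : E →L[ℝ] ℝ := (fderiv ℝ h x₀ (X x₀))⁻¹ • fderiv ℝ h x₀
  let π : E →L[ℝ] E := .id ℝ E - ℓ.smulRight (X x₀)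
  have hπX : π (X x₀) = 0 := by simp [π, ℓ, hne]
  let g (z : E) : ℝ := f (Φ.symm z)
  have hg : SmoothNear g 0 := SmoothNear.comp (hΦ.symm_zero.symm ▸ hf) hΦ.smooth_symm
  have hπΦ₀ : π (Φ x₀) = 0 := by rw [hΦ.map_self, map_zero]
  have hπΦ : SmoothNear (fun x ↦ π (Φ x)) x₀ := (SmoothNear.clm π).comp hΦ.smooth
  have hF' {x : E} (hx : SmoothNear Φ x) (hgx : SmoothNear g (π (Φ x))) (w : E) :
      fderiv ℝ (fun x ↦ g (π (Φ x))) x w = fderiv ℝ g (π (Φ x)) (π (fderiv ℝ Φ x w)) := by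
    rw [hgx.fderiv_comp_apply (f := fun x ↦ π (Φ x)) (SmoothNear.comp (.clm π) hx),
      SmoothNear.fderiv_comp_apply (.clm π) hx, π.fderiv]
  refine ⟨fun x ↦ g (π (Φ x)), SmoothNear.comp (f := fun x ↦ π (Φ x)) (by rwa [hπΦ₀]) hπΦ, ?_, ?_,
    -(fderiv ℝ h x₀ (X x₀))⁻¹ * fderiv ℝ f x₀ (X x₀), ?_⟩
  · filter_upwards [hΦ.smooth.eventually, hΦ.fderiv_field,
      hπΦ.continuousAt.eventually (hπΦ₀.symm ▸ hg.eventually)] with x hx hX hgx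
    rw [hF' hx hgx, hX, hπX, map_zero]
  · filter_upwards [hΦ.level_iff, hΦ.eventually_symm_apply] with x hx hΦx hxh
    have hπx : π (Φ x) = Φ x := by simp [π, ℓ, hx.mp hxh]
    rw [hπx]
    exact congrArg f hΦx
  · ext w
    rw [hF' hΦ.smooth (by rwa [hπΦ₀]), hπΦ₀, SmoothNear.fderiv_comp_apply
      (hΦ.symm_zero.symm ▸ hf) hΦ.smooth_symm, hΦ.symm_zero, hΦ.fderiv_symm_zero, hΦ.fderiv_self]
    simp [π, ℓ]
    ring

theorem first_integral_unique (hX : SmoothNear X x₀) (hh : SmoothNear h x₀)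
    (hne : fderiv ℝ h x₀ (X x₀) ≠ 0) {F : E → ℝ} (hF : SmoothNear F x₀)
    (hXF : ∀ᶠ x in 𝓝 x₀, fderiv ℝ F x (X x) = 0)
    (hF0 : ∀ᶠ x in 𝓝 x₀, h x = h x₀ → F x = 0) : ∀ᶠ x in 𝓝 x₀, F x = 0 := by
  obtain ⟨Φ, hΦ⟩ := exists_isFlowBox hX hh hne
  let ℓ : E →L[ℝ] ℝ := (fderiv ℝ h x₀ (X x₀))⁻¹ • fderiv ℝ h x₀
  let π : E →L[ℝ] E := .id ℝ E - ℓ.smulRight (X x₀)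
  have hdiff : ∀ᶠ z in 𝓝 0, DifferentiableAt ℝ (fun z ↦ F (Φ.symm z)) z ∧
      fderiv ℝ (fun z ↦ F (Φ.symm z)) z (X x₀) = 0 := by
    filter_upwards [hΦ.smooth_symm.eventually, hΦ.tendsto_symm.eventually hF.eventually,
      hΦ.fderiv_symm_field, hΦ.tendsto_symm.eventually hXF] with z hΦz hFz hXz hXFz
    exact ⟨(hFz.comp hΦz).differentiableAt, by rw [hFz.fderiv_comp_apply hΦz, hXz, hXFz]⟩
  obtain ⟨ε, hε, hball⟩ := Metric.eventually_nhds_iff_ball.mp hdiff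
  have hπΦ : Tendsto (fun x ↦ π (Φ x)) (𝓝 x₀) (𝓝 0) := by
    simpa only [map_zero, Function.comp_def] using (π.continuous.tendsto 0).comp hΦ.tendsto
  have hsurf : ∀ᶠ z in 𝓝 0, fderiv ℝ h x₀ z = 0 → F (Φ.symm z) = 0 := by
    filter_upwards [hΦ.tendsto_symm.eventually (hΦ.level_iff.and hF0),
      Φ.open_target.mem_nhds (hΦ.map_self ▸ Φ.map_source hΦ.mem_source)] with z hz hzt h0
    exact hz.2 (hz.1.mpr (by rwa [Φ.right_inv hzt]))
  filter_upwards [hΦ.tendsto.eventually (Metric.ball_mem_nhds 0 hε),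
    hπΦ.eventually (Metric.ball_mem_nhds 0 hε), hπΦ.eventually hsurf,
    hΦ.eventually_symm_apply] with x hx hπx hsurfx hΦx
  have hπ0 : fderiv ℝ h x₀ (π (Φ x)) = 0 := by simp [π, ℓ, hne, mul_right_comm]
  have hline : Φ x - π (Φ x) = ℓ (Φ x) • X x₀ := by simp [π]
  rw [← hsurfx hπ0, eq_of_fderiv_sub_eq_zero (convex_ball 0 ε) (fun z hz ↦ (hball z hz).1) hπx hx
    fun z hz ↦ by rw [hline, map_smul, (hball z hz).2, smul_zero], hΦx]

theorem first_integral_unique_on (V : Submodule ℝ E) (hx₀ : x₀ ∈ V) (hX : SmoothNear X x₀)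
    (hXV : ∀ᶠ x in 𝓝 x₀, x ∈ V → X x ∈ V) (hh : SmoothNear h x₀)
    (hne : fderiv ℝ h x₀ (X x₀) ≠ 0) {F : E → ℝ} (hF : SmoothNear F x₀)
    (hXF : ∀ᶠ x in 𝓝 x₀, x ∈ V → fderiv ℝ F x (X x) = 0)
    (hF0 : ∀ᶠ x in 𝓝 x₀, x ∈ V → h x = h x₀ → F x = 0) :
    ∀ᶠ x in 𝓝 x₀, x ∈ V → F x = 0 := by
  obtain ⟨P, hP⟩ := V.subtype.exists_leftInverse_of_injective V.ker_subtype
  have hPV {v : E} (hv : v ∈ V) : (P v : E) = v :=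
    congrArg Subtype.val (DFunLike.congr_fun hP ⟨v, hv⟩)
  let y₀ : V := ⟨x₀, hx₀⟩
  let ι : V →L[ℝ] E := V.subtypeL
  have hι : Tendsto ι (𝓝 y₀) (𝓝 x₀) := ι.continuous.tendsto y₀
  have hcomp {g : E → ℝ} (hg : SmoothNear g x₀) : SmoothNear (fun y ↦ g (ι y)) y₀ :=
    SmoothNear.comp (f := ι) hg (.clm ι)
  have hderiv {g : E → ℝ} {y : V} (hg : SmoothNear g (ι y)) (w : V) :
      fderiv ℝ (fun z ↦ g (ι z)) y w = fderiv ℝ g (ι y) (ι w) := by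
    rw [hg.fderiv_comp_apply (.clm ι), ι.fderiv]
  let Y (y : V) : V := P (X (ι y))
  have hY : SmoothNear Y y₀ := (SmoothNear.clm P.toContinuousLinearMap).comp
    (f := fun y ↦ X (ι y)) (SmoothNear.comp (f := ι) hX (.clm ι))
  have hYX : ∀ᶠ y in 𝓝 y₀, ι (Y y) = X (ι y) := by
    filter_upwards [hι.eventually hXV] with y hy using hPV (hy y.2)
  have hFV : ∀ᶠ y in 𝓝 y₀, F (ι y) = 0 := by
    refine first_integral_unique hY (hcomp hh) ?_ (hcomp hF) ?_ ?_
    · rwa [hderiv hh, hYX.self_of_nhds]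
    · filter_upwards [hYX, hι.eventually hF.eventually, hι.eventually hXF] with y hYy hFy hXFy
      rw [hderiv hFy, hYy, hXFy y.2]
    · filter_upwards [hι.eventually hF0] with y hy using hy y.2
  rw [nhds_subtype, eventually_comap] at hFV
  filter_upwards [hFV] with x hx hxV using hx ⟨x, hxV⟩ rfl

end FirstIntegral

theorem fderiv_apply_eq_zero_of_levelSet [CompleteSpace E] {h f : E → ℝ} {x v : E}
    (hh : SmoothNear h x) (hf : SmoothNear f x) (hh' : fderiv ℝ h x ≠ 0)
    (hhf : ∀ᶠ y in 𝓝 x, h y = h x → f y = 0) (hv : fderiv ℝ h x v = 0) : fderiv ℝ f x v = 0 := by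
  have hstrict {g : E → ℝ} (hg : SmoothNear g x) : HasStrictFDerivAt g (fderiv ℝ g x) x :=
    hg.contDiffAt.hasStrictFDerivAt (by simp)
  have hmin : IsLocalMinOn f {y | h y = h x} x := by
    filter_upwards [nhdsWithin_le_nhds hhf, self_mem_nhdsWithin] with y hy hyx
    rw [hy hyx, hhf.self_of_nhds rfl]
  obtain ⟨a, b, hab, heq⟩ :=
    IsLocalExtrOn.exists_multipliers_of_hasStrictFDerivAt_1d (.inl hmin) (hstrict hh) (hstrict hf)
  have hb : b ≠ 0 := by
    rintro rfl
    have ha : a ≠ 0 := by simpa using hab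
    exact hh' (by simpa [ha] using heq)
  simpa [hv, hb] using DFunLike.congr_fun heq v

end FlowBox

section LocalPoisson

variable {E : Type*} [NormedAddCommGroup E] [NormedSpace ℝ E]

/-- The bracket `{f, g}` of two functions on a normed space defined by a family of bilinear forms
on covectors. -/
def localBracket (B : E → (E →L[ℝ] ℝ) →L[ℝ] (E →L[ℝ] ℝ) →L[ℝ] ℝ) (f g : E → ℝ) (x : E) : ℝ :=
  B x (fderiv ℝ f x) (fderiv ℝ g x)

/-- `B` is a smooth Poisson bivector near `x₀`. -/
structure IsPoissonNear (B : E → (E →L[ℝ] ℝ) →L[ℝ] (E →L[ℝ] ℝ) →L[ℝ] ℝ) (x₀ : E) : Prop where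
  smooth : SmoothNear B x₀
  skew : ∀ᶠ x in 𝓝 x₀, ∀ α β, B x α β = -B x β α
  jacobi : ∀ᶠ x in 𝓝 x₀, ∀ f g h : E → ℝ, SmoothNear f x → SmoothNear g x → SmoothNear h x →
    localBracket B f (localBracket B g h) x + localBracket B g (localBracket B h f) x +
      localBracket B h (localBracket B f g) x = 0

/-- The functions `f` and `g` are in involution near `x₀`: their bracket vanishes there. -/
def PoissonCommute (B : E → (E →L[ℝ] ℝ) →L[ℝ] (E →L[ℝ] ℝ) →L[ℝ] ℝ) (x₀ : E) (f g : E → ℝ) :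
    Prop :=
  ∀ᶠ x in 𝓝 x₀, localBracket B f g x = 0

/-- The Hamiltonian vector field `{f, ·}` of a function, written in an auxiliary basis of `E`. -/
def hamiltonianField [FiniteDimensional ℝ E]
    (B : E → (E →L[ℝ] ℝ) →L[ℝ] (E →L[ℝ] ℝ) →L[ℝ] ℝ) (f : E → ℝ) (x : E) : E :=
  ∑ i, B x (fderiv ℝ f x) (LinearMap.toContinuousLinearMap ((Module.finBasis ℝ E).coord i)) •
    Module.finBasis ℝ E i

variable {B : E → (E →L[ℝ] ℝ) →L[ℝ] (E →L[ℝ] ℝ) →L[ℝ] ℝ} {x₀ : E} {f g h : E → ℝ}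

theorem localBracket_congr_right {g' : E → ℝ} {x : E} (hg : g =ᶠ[𝓝 x] g') :
    localBracket B f g x = localBracket B f g' x := by
  rw [localBracket, hg.fderiv_eq, localBracket]

theorem localBracket_eq_zero_of_eventually_const {x : E} {c : ℝ} (hg : ∀ᶠ y in 𝓝 x, g y = c) :
    localBracket B f g x = 0 := by
  rw [localBracket_congr_right (g' := fun _ ↦ c) hg]
  simp [localBracket]

theorem localBracket_neg_right (f g : E → ℝ) (x : E) :
    localBracket B f (fun y ↦ -g y) x = -localBracket B f g x := by
  rw [localBracket, fderiv_fun_neg, map_neg, localBracket]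

theorem apply_hamiltonianField [FiniteDimensional ℝ E] (f : E → ℝ) (x : E) (α : E →L[ℝ] ℝ) :
    α (hamiltonianField B f x) = B x (fderiv ℝ f x) α := by
  have hα : α = ∑ i, α (Module.finBasis ℝ E i) •
      LinearMap.toContinuousLinearMap ((Module.finBasis ℝ E).coord i) := by
    ext v
    conv_lhs => rw [← (Module.finBasis ℝ E).sum_repr v, map_sum]
    simp [mul_comm]
  conv_rhs => rw [hα]
  simp [hamiltonianField, mul_comm]

theorem fderiv_hamiltonianField [FiniteDimensional ℝ E] (f g : E → ℝ) (x : E) :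
    fderiv ℝ g x (hamiltonianField B f x) = localBracket B f g x :=
  apply_hamiltonianField f x _

namespace IsPoissonNear

theorem bracket_smooth (hB : IsPoissonNear B x₀) (hf : SmoothNear f x₀) (hg : SmoothNear g x₀) :
    SmoothNear (localBracket B f g) x₀ :=
  (hB.smooth.clm_apply hf.fderiv).clm_apply hg.fderiv

theorem hamiltonianField_smooth [FiniteDimensional ℝ E] (hB : IsPoissonNear B x₀)
    (hf : SmoothNear f x₀) : SmoothNear (hamiltonianField B f) x₀ :=
  SmoothNear.sum fun _ _ ↦
    ((hB.smooth.clm_apply hf.fderiv).clm_apply (.const _)).smul (.const _)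

theorem bracket_skew (hB : IsPoissonNear B x₀) (f g : E → ℝ) :
    ∀ᶠ x in 𝓝 x₀, localBracket B f g x = -localBracket B g f x :=
  hB.skew.mono fun _ hx ↦ hx _ _

theorem commute_self (hB : IsPoissonNear B x₀) (f : E → ℝ) : PoissonCommute B x₀ f f :=
  (hB.bracket_skew f f).mono fun _ hx ↦ self_eq_neg.mp hx

theorem commute_symm (hB : IsPoissonNear B x₀) (hfg : PoissonCommute B x₀ f g) :
    PoissonCommute B x₀ g f := by
  filter_upwards [hfg, hB.bracket_skew g f] with x hx hskew
  rw [hskew, hx, neg_zero]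

theorem bracket_left_comm (hB : IsPoissonNear B x₀) (hf : SmoothNear f x₀) (hg : SmoothNear g x₀)
    (hh : SmoothNear h x₀) {c : ℝ} (hfg : ∀ᶠ x in 𝓝 x₀, localBracket B f g x = c) :
    ∀ᶠ x in 𝓝 x₀, localBracket B f (localBracket B g h) x =
      localBracket B g (localBracket B f h) x := by
  filter_upwards [hB.jacobi, hf.eventually, hg.eventually, hh.eventually, hfg.eventually_nhds,
    (hB.bracket_skew h f).eventually_nhds] with x hjacobi hf hg hh hfg hskew
  have := hjacobi f g h hf hg hh
  rw [localBracket_eq_zero_of_eventually_const hfg, localBracket_congr_right (f := g) hskew,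
    localBracket_neg_right] at this
  linarith

variable [FiniteDimensional ℝ E]

theorem commute_of_eq_on_levelSet (hB : IsPoissonNear B x₀) {G F K : E → ℝ}
    (hG : SmoothNear G x₀) (hh : SmoothNear h x₀) (hF : SmoothNear F x₀) (hf : SmoothNear f x₀)
    (hK : SmoothNear K x₀) (hne : localBracket B G h x₀ ≠ 0) {c d : ℝ}
    (hGF : ∀ᶠ x in 𝓝 x₀, localBracket B G F x = c) (hFf : ∀ᶠ x in 𝓝 x₀, h x = h x₀ → F x = f x)
    (hKG : ∀ᶠ x in 𝓝 x₀, localBracket B K G x = d) (hKh : PoissonCommute B x₀ K h)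
    (hKf : PoissonCommute B x₀ K f) : PoissonCommute B x₀ K F := by
  have : CompleteSpace E := FiniteDimensional.complete ℝ E
  refine first_integral_unique (hB.hamiltonianField_smooth hG) hh ?_ (hB.bracket_smooth hK hF) ?_ ?_
  · rwa [fderiv_hamiltonianField]
  · filter_upwards [hB.bracket_left_comm hK hG hF hKG, hGF.eventually_nhds] with x hcomm hGFx
    rw [fderiv_hamiltonianField, ← hcomm, localBracket_eq_zero_of_eventually_const hGFx]
  · filter_upwards [hF.eventually, hf.eventually, hh.eventually, hFf.eventually_nhds, hKh, hKf,
      (hB.bracket_smooth hG hh).continuousAt.eventually_ne hne]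
      with x hFx hfx hhx hFfx hKhx hKfx hnex hx
    have hdh : fderiv ℝ h x ≠ 0 := fun h0 ↦ hnex (by rw [localBracket, h0, map_zero])
    have := fderiv_apply_eq_zero_of_levelSet hhx (hFx.sub hfx) hdh
      (hFfx.mono fun y hy hyx ↦ sub_eq_zero.mpr (hy (hyx.trans hx)))
      ((fderiv_hamiltonianField K h x).trans hKhx)
    rwa [fderiv_hamiltonianField, localBracket, fderiv_fun_sub hFx.differentiableAt
      hfx.differentiableAt, map_sub, ← localBracket, ← localBracket, hKfx, sub_zero] at this

theorem exists_commuting (hB : IsPoissonNear B x₀) {G H : E → ℝ} (hG : SmoothNear G x₀)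
    (hH : SmoothNear H x₀) (hf : SmoothNear f x₀) (hne : localBracket B G H x₀ ≠ 0) :
    ∃ F : E → ℝ, SmoothNear F x₀ ∧ PoissonCommute B x₀ G F ∧
      (∀ᶠ x in 𝓝 x₀, H x = H x₀ → F x = f x) ∧
      (∃ c : ℝ, fderiv ℝ F x₀ = fderiv ℝ f x₀ + c • fderiv ℝ H x₀) ∧
      ∀ K : E → ℝ, SmoothNear K x₀ → (∃ d, ∀ᶠ x in 𝓝 x₀, localBracket B K G x = d) →
        PoissonCommute B x₀ K H → PoissonCommute B x₀ K f → PoissonCommute B x₀ K F := by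
  obtain ⟨F, hF, hGF, hFf, hdF⟩ := exists_first_integral (hB.hamiltonianField_smooth hG) hH
    (by rwa [fderiv_hamiltonianField]) hf
  simp only [fderiv_hamiltonianField] at hGF
  exact ⟨F, hF, hGF, hFf, hdF, fun K hK ⟨d, hd⟩ hKH hKf ↦
    hB.commute_of_eq_on_levelSet hG hH hF hf hK hne hGF hFf hd hKH hKf⟩

theorem exists_conjugate (hB : IsPoissonNear B x₀) {P : E → ℝ} (hP : SmoothNear P x₀)
    (hh : SmoothNear h x₀) (hne : localBracket B P h x₀ ≠ 0) :
    ∃ Q : E → ℝ, SmoothNear Q x₀ ∧ (∀ᶠ x in 𝓝 x₀, localBracket B Q P x = 1) ∧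
      ∀ K : E → ℝ, SmoothNear K x₀ → PoissonCommute B x₀ K P → PoissonCommute B x₀ K h →
        PoissonCommute B x₀ K Q := by
  obtain ⟨τ, hτ, hPτ, hτ0⟩ := exists_time_function (hB.hamiltonianField_smooth hP) hh
    (by rwa [fderiv_hamiltonianField])
  simp only [fderiv_hamiltonianField] at hPτ
  refine ⟨fun x ↦ -τ x, hτ.neg, ?_, fun K hK hKP hKh ↦ ?_⟩
  · filter_upwards [hPτ, hB.bracket_skew (fun x ↦ -τ x) P] with x hx hskew
    rw [hskew, localBracket_neg_right, hx, neg_neg]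
  · have hK0 : PoissonCommute B x₀ K fun _ ↦ 0 := Eventually.of_forall fun x ↦
      localBracket_eq_zero_of_eventually_const (Eventually.of_forall fun _ ↦ rfl)
    filter_upwards [hB.commute_of_eq_on_levelSet hP hh hτ (.const 0) hK hne hPτ hτ0 hKP hKh hK0]
      with x hx
    rw [localBracket_neg_right, hx, neg_zero]

end IsPoissonNear

/-- Near `x₀` the linear subspace `V` is coisotropic with respect to `B`. -/
def IsCoisotropicNear (B : E → (E →L[ℝ] ℝ) →L[ℝ] (E →L[ℝ] ℝ) →L[ℝ] ℝ) (V : Submodule ℝ E)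
    (x₀ : E) : Prop :=
  ∀ᶠ x in 𝓝 x₀, x ∈ V → ∀ α β : E →L[ℝ] ℝ, (∀ v ∈ V, α v = 0) → (∀ v ∈ V, β v = 0) → B x α β = 0

variable {V : Submodule ℝ E}

theorem fderiv_apply_eq_zero_of_eventually_mem {x v : E} (hf : DifferentiableAt ℝ f x)
    (hfV : ∀ᶠ y in 𝓝 x, y ∈ V → f y = 0) (hx : x ∈ V) (hv : v ∈ V) : fderiv ℝ f x v = 0 := by
  have hline : HasDerivAt (fun t : ℝ ↦ x + t • v) v 0 := by
    simpa using ((hasDerivAt_id (0 : ℝ)).smul_const v).const_add x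
  have hcomp : HasDerivAt (fun t : ℝ ↦ f (x + t • v)) (fderiv ℝ f x v) 0 :=
    HasFDerivAt.comp_hasDerivAt (0 : ℝ) (by simpa using hf.hasFDerivAt) hline
  have hlim : Tendsto (fun t : ℝ ↦ x + t • v) (𝓝 0) (𝓝 x) := by
    simpa using hline.continuousAt.tendsto
  refine hcomp.unique ((hasDerivAt_const (0 : ℝ) (0 : ℝ)).congr_of_eventuallyEq ?_)
  filter_upwards [hlim.eventually hfV] with t ht using ht (V.add_mem hx (V.smul_mem t hv))

theorem mem_of_forall_annihilator [FiniteDimensional ℝ E] {w : E}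
    (h : ∀ α : E →L[ℝ] ℝ, (∀ v ∈ V, α v = 0) → α w = 0) : w ∈ V := by
  by_contra hw
  obtain ⟨α, hα, hV⟩ := Submodule.exists_le_ker_of_notMem hw
  exact hα (h (LinearMap.toContinuousLinearMap α) fun v hv ↦ hV hv)

theorem IsCoisotropicNear.hamiltonianField_mem [FiniteDimensional ℝ E]
    (hV : IsCoisotropicNear B V x₀) (hf : SmoothNear f x₀)
    (hfV : ∀ᶠ x in 𝓝 x₀, x ∈ V → f x = 0) :
    ∀ᶠ x in 𝓝 x₀, x ∈ V → hamiltonianField B f x ∈ V := by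
  filter_upwards [hV, hf.eventually, hfV.eventually_nhds] with x hVx hfx hfVx hx
  refine mem_of_forall_annihilator fun α hα ↦ ?_
  rw [apply_hamiltonianField]
  exact hVx hx _ _
    (fun v hv ↦ fderiv_apply_eq_zero_of_eventually_mem hfx.differentiableAt hfVx hx hv) hα

theorem IsCoisotropicNear.localBracket_eq_zero (hV : IsCoisotropicNear B V x₀) (hx₀ : x₀ ∈ V)
    (hf : SmoothNear f x₀) (hg : SmoothNear g x₀) (hfV : ∀ᶠ x in 𝓝 x₀, x ∈ V → f x = 0)
    (hgV : ∀ᶠ x in 𝓝 x₀, x ∈ V → g x = 0) : localBracket B f g x₀ = 0 :=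
  hV.self_of_nhds hx₀ _ _
    (fun _ hv ↦ fderiv_apply_eq_zero_of_eventually_mem hf.differentiableAt hfV hx₀ hv)
    (fun _ hv ↦ fderiv_apply_eq_zero_of_eventually_mem hg.differentiableAt hgV hx₀ hv)

end LocalPoisson

section CanonicalSystem

variable {E : Type*} [NormedAddCommGroup E] [NormedSpace ℝ E]
  {B : E → (E →L[ℝ] ℝ) →L[ℝ] (E →L[ℝ] ℝ) →L[ℝ] ℝ} {V : Submodule ℝ E} {x₀ : E} {f : E → ℝ}

theorem exists_annihilator_notMem [FiniteDimensional ℝ E] {W : Submodule ℝ (E →L[ℝ] ℝ)}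
    (hVW : Module.finrank ℝ V + Module.finrank ℝ W < Module.finrank ℝ E) :
    ∃ α : E →L[ℝ] ℝ, (∀ v ∈ V, α v = 0) ∧ α ∉ W := by
  by_contra! hcon
  let e : (E →ₗ[ℝ] ℝ) ≃ₗ[ℝ] (E →L[ℝ] ℝ) := LinearMap.toContinuousLinearMap
  have hle : V.dualAnnihilator.map e.toLinearMap ≤ W := by
    rintro _ ⟨φ, hφ, rfl⟩
    exact hcon _ fun v hv ↦ (Submodule.mem_dualAnnihilator φ).mp hφ v hv
  have hle' : Module.finrank ℝ V.dualAnnihilator ≤ Module.finrank ℝ W :=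
    (e.finrank_map_eq V.dualAnnihilator).symm.trans_le (Submodule.finrank_mono hle)
  exact ((Nat.add_le_add_left hle' _).trans_lt hVW).ne
    (Subspace.finrank_add_finrank_dualAnnihilator_eq V)

theorem IsCoisotropicNear.eq_zero_of_commute [FiniteDimensional ℝ E]
    (hV : IsCoisotropicNear B V x₀) (hB : IsPoissonNear B x₀) (hx₀ : x₀ ∈ V) {P Q F : E → ℝ}
    (hP : SmoothNear P x₀) (hQ : SmoothNear Q x₀) (hF : SmoothNear F x₀)
    (hPV : ∀ᶠ x in 𝓝 x₀, x ∈ V → P x = 0) (hne : localBracket B P Q x₀ ≠ 0)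
    (hPF : PoissonCommute B x₀ P F) (hF0 : ∀ᶠ x in 𝓝 x₀, x ∈ V → Q x = Q x₀ → F x = 0) :
    ∀ᶠ x in 𝓝 x₀, x ∈ V → F x = 0 := by
  refine first_integral_unique_on V hx₀ (hB.hamiltonianField_smooth hP)
    (hV.hamiltonianField_mem hP hPV) hQ ?_ hF ?_ hF0
  · rwa [fderiv_hamiltonianField]
  · filter_upwards [hPF] with x hx _
    rw [fderiv_hamiltonianField, hx]

theorem IsPoissonNear.exists_commuting_pair [FiniteDimensional ℝ E] (hB : IsPoissonNear B x₀)
    {Q P : E → ℝ} (hQ : SmoothNear Q x₀) (hP : SmoothNear P x₀)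
    (hQP : ∀ᶠ x in 𝓝 x₀, localBracket B Q P x = 1) (hf : SmoothNear f x₀) :
    ∃ F : E → ℝ, SmoothNear F x₀ ∧ PoissonCommute B x₀ Q F ∧ PoissonCommute B x₀ P F ∧
      (∃ c d : ℝ, fderiv ℝ F x₀ = fderiv ℝ f x₀ + (c • fderiv ℝ Q x₀ + d • fderiv ℝ P x₀)) ∧
      (∀ K : E → ℝ, SmoothNear K x₀ → PoissonCommute B x₀ K Q → PoissonCommute B x₀ K P →
        PoissonCommute B x₀ K f → PoissonCommute B x₀ K F) ∧
      ∀ V : Submodule ℝ E, IsCoisotropicNear B V x₀ → x₀ ∈ V → (∀ᶠ x in 𝓝 x₀, x ∈ V → P x = 0) →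
        (∀ᶠ x in 𝓝 x₀, x ∈ V → f x = 0) → ∀ᶠ x in 𝓝 x₀, x ∈ V → F x = 0 := by
  have hPQ : ∀ᶠ x in 𝓝 x₀, localBracket B P Q x = -1 := by
    filter_upwards [hQP, hB.bracket_skew P Q] with x hx hskew
    rw [hskew, hx]
  have hQP₀ : localBracket B Q P x₀ ≠ 0 := by simp [hQP.self_of_nhds]
  have hPQ₀ : localBracket B P Q x₀ ≠ 0 := by simp [hPQ.self_of_nhds]
  obtain ⟨F₁, hF₁, hPF₁, hF₁f, ⟨c, hc⟩, hK₁⟩ := hB.exists_commuting hP hQ hf hPQ₀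
  obtain ⟨F, hF, hQF, hFF₁, ⟨d, hd⟩, hK⟩ := hB.exists_commuting hQ hP hF₁ hQP₀
  refine ⟨F, hF, hQF, hK P hP ⟨-1, hPQ⟩ (hB.commute_self P) hPF₁,
    ⟨c, d, by rw [hd, hc, add_assoc]⟩, fun K hKs hKQ hKP hKf ↦
      hK K hKs ⟨0, hKQ⟩ hKP (hK₁ K hKs ⟨0, hKP⟩ hKQ hKf), fun V hV hx₀ hPV hfV ↦ ?_⟩
  have hF₁V := hV.eq_zero_of_commute hB hx₀ hP hQ hF₁ hPV hPQ₀ hPF₁ (by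
    filter_upwards [hF₁f, hfV] with x hx hfx hxV hxQ
    rw [hx hxQ, hfx hxV])
  filter_upwards [hFF₁, hF₁V, hPV] with x hx hF₁x hPx hxV
  rw [hx (by rw [hPx hxV, hPV.self_of_nhds hx₀]), hF₁x hxV]

/-- The functions `q a`, `p a` satisfy the canonical commutation relations near `x₀`, and the
functions `p a` vanish on the linear subspace `V`. -/
structure IsCanonicalSystem {ι : Type*} (B : E → (E →L[ℝ] ℝ) →L[ℝ] (E →L[ℝ] ℝ) →L[ℝ] ℝ)
    (V : Submodule ℝ E) (x₀ : E) (q p : ι → E → ℝ) : Prop where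
  smooth_q (a : ι) : SmoothNear (q a) x₀
  smooth_p (a : ι) : SmoothNear (p a) x₀
  commute_qq (a b : ι) : PoissonCommute B x₀ (q a) (q b)
  commute_pp (a b : ι) : PoissonCommute B x₀ (p a) (p b)
  commute_qp {a b : ι} (hab : a ≠ b) : PoissonCommute B x₀ (q a) (p b)
  bracket_qp (a : ι) : ∀ᶠ x in 𝓝 x₀, localBracket B (q a) (p a) x = 1
  vanish_p (a : ι) : ∀ᶠ x in 𝓝 x₀, x ∈ V → p a x = 0

/-- The span of the differentials at `x₀` of the functions `u a`. -/
def differentialSpan {ι : Type*} (x₀ : E) (u : ι → E → ℝ) : Submodule ℝ (E →L[ℝ] ℝ) :=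
  Submodule.span ℝ (range fun a ↦ fderiv ℝ (u a) x₀)

theorem fderiv_mem_differentialSpan {ι : Type*} (u : ι → E → ℝ) (a : ι) :
    fderiv ℝ (u a) x₀ ∈ differentialSpan x₀ u :=
  Submodule.subset_span ⟨a, rfl⟩

namespace IsCanonicalSystem

section Finite

variable {ι : Type*} {q p : ι → E → ℝ}

theorem apply_fderiv_q_sum [Fintype ι] (H : IsCanonicalSystem B V x₀ q p) (c d : ι → ℝ) (a : ι) :
    B x₀ (fderiv ℝ (q a) x₀) (∑ b, c b • fderiv ℝ (q b) x₀ + ∑ b, d b • fderiv ℝ (p b) x₀) =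
      d a := by
  have hqq (b : ι) : B x₀ (fderiv ℝ (q a) x₀) (fderiv ℝ (q b) x₀) = 0 :=
    (H.commute_qq a b).self_of_nhds
  have hqp (b : ι) (hb : b ≠ a) : B x₀ (fderiv ℝ (q a) x₀) (fderiv ℝ (p b) x₀) = 0 :=
    (H.commute_qp hb.symm).self_of_nhds
  have hqp' : B x₀ (fderiv ℝ (q a) x₀) (fderiv ℝ (p a) x₀) = 1 := (H.bracket_qp a).self_of_nhds
  rw [map_add, map_sum, map_sum, Finset.sum_eq_zero fun b _ ↦ by rw [map_smul, hqq, smul_zero],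
    Finset.sum_eq_single a (fun b _ hb ↦ by rw [map_smul, hqp b hb, smul_zero]) (by simp),
    map_smul, hqp', zero_add, smul_eq_mul, mul_one]

theorem apply_fderiv_p_sum [Fintype ι] (H : IsCanonicalSystem B V x₀ q p) (hB : IsPoissonNear B x₀)
    (c d : ι → ℝ) (a : ι) :
    B x₀ (fderiv ℝ (p a) x₀) (∑ b, c b • fderiv ℝ (q b) x₀ + ∑ b, d b • fderiv ℝ (p b) x₀) =
      -c a := by
  have hpp (b : ι) : B x₀ (fderiv ℝ (p a) x₀) (fderiv ℝ (p b) x₀) = 0 :=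
    (H.commute_pp a b).self_of_nhds
  have hpq (b : ι) (hb : b ≠ a) : B x₀ (fderiv ℝ (p a) x₀) (fderiv ℝ (q b) x₀) = 0 :=
    (hB.commute_symm (H.commute_qp hb)).self_of_nhds
  have hpq' : B x₀ (fderiv ℝ (p a) x₀) (fderiv ℝ (q a) x₀) = -1 :=
    (hB.bracket_skew (p a) (q a)).self_of_nhds.trans (by rw [(H.bracket_qp a).self_of_nhds])
  rw [map_add, map_sum, map_sum, Finset.sum_eq_single a
      (fun b _ hb ↦ by rw [map_smul, hpq b hb, smul_zero]) (by simp),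
    Finset.sum_eq_zero fun b _ ↦ by rw [map_smul, hpp, smul_zero], map_smul, hpq', add_zero,
    smul_eq_mul, mul_neg_one]

theorem linearIndependent [Finite ι] (H : IsCanonicalSystem B V x₀ q p) (hB : IsPoissonNear B x₀) :
    LinearIndependent ℝ
      (Sum.elim (fun a ↦ fderiv ℝ (q a) x₀) (fun a ↦ fderiv ℝ (p a) x₀)) := by
  have := Fintype.ofFinite ι
  rw [Fintype.linearIndependent_iff]
  intro c hc
  rw [Fintype.sum_sum_type] at hc
  simp only [Sum.elim_inl, Sum.elim_inr] at hc
  rintro (a | a)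
  · simpa [hc] using H.apply_fderiv_p_sum hB (fun b ↦ c (.inl b)) (fun b ↦ c (.inr b)) a
  · simpa [hc] using (H.apply_fderiv_q_sum (fun b ↦ c (.inl b)) (fun b ↦ c (.inr b)) a).symm

theorem mem_differentialSpan_p [Finite ι] (H : IsCanonicalSystem B V x₀ q p)
    (hB : IsPoissonNear B x₀) {α : E →L[ℝ] ℝ}
    (hα : α ∈ differentialSpan x₀ q ⊔ differentialSpan x₀ p)
    (hpα : ∀ a, B x₀ (fderiv ℝ (p a) x₀) α = 0) : α ∈ differentialSpan x₀ p := by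
  have := Fintype.ofFinite ι
  obtain ⟨β, hβ, γ, hγ, rfl⟩ := Submodule.mem_sup.mp hα
  obtain ⟨c, rfl⟩ := (Submodule.mem_span_range_iff_exists_fun ℝ).mp hβ
  obtain ⟨d, rfl⟩ := (Submodule.mem_span_range_iff_exists_fun ℝ).mp hγ
  have hc (a : ι) : c a = 0 := by
    rw [← neg_eq_zero, ← H.apply_fderiv_p_sum hB c d, hpα]
  simpa [hc] using hγ

variable [FiniteDimensional ℝ E]

theorem exists_commuting [Finite ι] (H : IsCanonicalSystem B V x₀ q p) (hB : IsPoissonNear B x₀)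
    (hV : IsCoisotropicNear B V x₀) (hx₀ : x₀ ∈ V) (hf : SmoothNear f x₀) :
    ∃ F : E → ℝ, SmoothNear F x₀ ∧ (∀ a, PoissonCommute B x₀ (q a) F) ∧
      (∀ a, PoissonCommute B x₀ (p a) F) ∧
      fderiv ℝ F x₀ - fderiv ℝ f x₀ ∈ differentialSpan x₀ q ⊔ differentialSpan x₀ p ∧
      ((∀ᶠ x in 𝓝 x₀, x ∈ V → f x = 0) → ∀ᶠ x in 𝓝 x₀, x ∈ V → F x = 0) := by
  classical
  have := Fintype.ofFinite ι
  suffices ∀ s : Finset ι, ∃ F : E → ℝ, SmoothNear F x₀ ∧ (∀ a ∈ s, PoissonCommute B x₀ (q a) F) ∧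
      (∀ a ∈ s, PoissonCommute B x₀ (p a) F) ∧
      fderiv ℝ F x₀ - fderiv ℝ f x₀ ∈ differentialSpan x₀ q ⊔ differentialSpan x₀ p ∧
      ((∀ᶠ x in 𝓝 x₀, x ∈ V → f x = 0) → ∀ᶠ x in 𝓝 x₀, x ∈ V → F x = 0) by
    simpa using this Finset.univ
  intro s
  induction s using Finset.induction with
  | empty => exact ⟨f, hf, by simp, by simp, by simp, id⟩
  | insert r s hr ih =>
    obtain ⟨F, hF, hqF, hpF, hdF, hFV⟩ := ih
    obtain ⟨G, hG, hqG, hpG, ⟨c, d, hdG⟩, hKG, hGV⟩ :=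
      hB.exists_commuting_pair (H.smooth_q r) (H.smooth_p r) (H.bracket_qp r) hF
    have hne {a : ι} (ha : a ∈ s) : a ≠ r := ne_of_mem_of_not_mem ha hr
    refine ⟨G, hG, (Finset.forall_mem_insert _ _ _).mpr ⟨hqG, fun a ha ↦ ?_⟩,
      (Finset.forall_mem_insert _ _ _).mpr ⟨hpG, fun a ha ↦ ?_⟩, ?_,
      fun hfV ↦ hGV V hV hx₀ (H.vanish_p r) (hFV hfV)⟩
    · exact hKG _ (H.smooth_q a) (H.commute_qq a r) (H.commute_qp (hne ha)) (hqF a ha)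
    · exact hKG _ (H.smooth_p a) (hB.commute_symm (H.commute_qp (hne ha).symm))
        (H.commute_pp a r) (hpF a ha)
    · rw [hdG, add_sub_right_comm]
      exact add_mem hdF (Submodule.add_mem_sup
        (Submodule.smul_mem _ _ (fderiv_mem_differentialSpan q r))
        (Submodule.smul_mem _ _ (fderiv_mem_differentialSpan p r)))

theorem exists_new_momentum [Fintype ι] (H : IsCanonicalSystem B V x₀ q p) (hB : IsPoissonNear B x₀)
    (hV : IsCoisotropicNear B V x₀) (hx₀ : x₀ ∈ V)
    (hcard : Module.finrank ℝ V + Fintype.card ι < Module.finrank ℝ E) :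
    ∃ P : E → ℝ, SmoothNear P x₀ ∧ (∀ a, PoissonCommute B x₀ (q a) P) ∧
      (∀ a, PoissonCommute B x₀ (p a) P) ∧ (∀ᶠ x in 𝓝 x₀, x ∈ V → P x = 0) ∧
      fderiv ℝ P x₀ ≠ 0 := by
  obtain ⟨α, hαV, hα⟩ := exists_annihilator_notMem (V := V) (W := differentialSpan x₀ p)
    ((Nat.add_le_add_left (finrank_range_le_card _) _).trans_lt hcard)
  have hαV' : ∀ᶠ x in 𝓝 x₀, x ∈ V → α x = 0 := Eventually.of_forall hαV
  obtain ⟨P, hP, hqP, hpP, hdP, hPV⟩ := H.exists_commuting hB hV hx₀ (SmoothNear.clm α)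
  rw [α.fderiv] at hdP
  refine ⟨P, hP, hqP, hpP, hPV hαV', fun hP0 ↦ hα (H.mem_differentialSpan_p hB ?_ fun a ↦ ?_)⟩
  · simpa [hP0] using hdP
  · simpa [localBracket] using
      hV.localBracket_eq_zero hx₀ (H.smooth_p a) (SmoothNear.clm α) (H.vanish_p a) hαV'

theorem exists_transverse [Finite ι] (H : IsCanonicalSystem B V x₀ q p) (hB : IsPoissonNear B x₀)
    (hV : IsCoisotropicNear B V x₀) (hx₀ : x₀ ∈ V) {P : E → ℝ}
    (hqP : ∀ a, PoissonCommute B x₀ (q a) P) (hpP : ∀ a, PoissonCommute B x₀ (p a) P)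
    {β : E →L[ℝ] ℝ} (hβ : B x₀ (fderiv ℝ P x₀) β ≠ 0) :
    ∃ h : E → ℝ, SmoothNear h x₀ ∧ (∀ a, PoissonCommute B x₀ (q a) h) ∧
      (∀ a, PoissonCommute B x₀ (p a) h) ∧ localBracket B P h x₀ ≠ 0 := by
  obtain ⟨h, hh, hqh, hph, hdh, -⟩ := H.exists_commuting hB hV hx₀ (SmoothNear.clm β)
  rw [β.fderiv] at hdh
  refine ⟨h, hh, hqh, hph, ?_⟩
  have hle : differentialSpan x₀ q ⊔ differentialSpan x₀ p ≤
      LinearMap.ker (B x₀ (fderiv ℝ P x₀)).toLinearMap := by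
    refine sup_le (Submodule.span_le.mpr ?_) (Submodule.span_le.mpr ?_)
    · rintro _ ⟨a, rfl⟩
      exact (hB.commute_symm (hqP a)).self_of_nhds
    · rintro _ ⟨a, rfl⟩
      exact (hB.commute_symm (hpP a)).self_of_nhds
  have hPh : B x₀ (fderiv ℝ P x₀) (fderiv ℝ h x₀ - β) = 0 := hle hdh
  rw [map_sub, sub_eq_zero] at hPh
  rwa [localBracket, hPh]

theorem exists_fderiv_p_eq [Finite ι] (H : IsCanonicalSystem B V x₀ q p) (c : ι → ℝ) :
    ∃ v, ∀ a, fderiv ℝ (p a) x₀ v = c a := by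
  have := Fintype.ofFinite ι
  classical
  refine ⟨∑ b, c b • hamiltonianField B (q b) x₀, fun a ↦ ?_⟩
  rw [map_sum, Finset.sum_eq_single a (fun b _ hb ↦ ?_) (by simp), map_smul,
    fderiv_hamiltonianField, (H.bracket_qp a).self_of_nhds, smul_eq_mul, mul_one]
  rw [map_smul, fderiv_hamiltonianField, (H.commute_qp hb).self_of_nhds, smul_zero]

theorem mem_of_fderiv_p [Fintype ι] (H : IsCanonicalSystem B V x₀ q p) (hx₀ : x₀ ∈ V)
    (hdim : Module.finrank ℝ E = Module.finrank ℝ V + Fintype.card ι) {v : E}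
    (hv : ∀ a, fderiv ℝ (p a) x₀ v = 0) : v ∈ V := by
  let D : E →ₗ[ℝ] ι → ℝ := LinearMap.pi fun a ↦ (fderiv ℝ (p a) x₀).toLinearMap
  have hD : LinearMap.range D = ⊤ := LinearMap.range_eq_top.mpr fun c ↦
    (H.exists_fderiv_p_eq c).imp fun _ hv ↦ funext hv
  have hrank := LinearMap.finrank_range_add_finrank_ker D
  rw [hD, finrank_top, Module.finrank_fintype_fun_eq_card, hdim, add_comm] at hrank
  have hVD : V = LinearMap.ker D := Submodule.eq_of_le_of_finrank_eq (fun w hw ↦ funext fun a ↦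
    fderiv_apply_eq_zero_of_eventually_mem (H.smooth_p a).differentiableAt (H.vanish_p a) hx₀ hw)
    (Nat.add_right_cancel hrank).symm
  rw [hVD]
  exact funext hv

theorem eventually_mem_of_p_eq_zero [Fintype ι] (H : IsCanonicalSystem B V x₀ q p) (hx₀ : x₀ ∈ V)
    (hdim : Module.finrank ℝ E = Module.finrank ℝ V + Fintype.card ι) :
    ∀ᶠ x in 𝓝 x₀, (∀ a, p a x = 0) → x ∈ V := by
  have : CompleteSpace E := FiniteDimensional.complete ℝ E
  obtain ⟨P', hP'⟩ := V.subtype.exists_leftInverse_of_injective V.ker_subtype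
  let P : E →L[ℝ] V := P'.toContinuousLinearMap
  have hP (v : V) : P v = v := DFunLike.congr_fun hP' v
  let Θ (x : E) : V × (ι → ℝ) := (P x, fun a ↦ p a x)
  have hΘ : SmoothNear Θ x₀ := (SmoothNear.clm P).prodMk
    ((eventually_all.mpr H.smooth_p).mono fun _ hx ↦ contDiffAt_pi.mpr hx)
  let Θ' : E →L[ℝ] V × (ι → ℝ) := P.prod (.pi fun a ↦ fderiv ℝ (p a) x₀)
  have hΘ' : HasFDerivAt Θ Θ' x₀ :=
    P.hasFDerivAt.prodMk (hasFDerivAt_pi.mpr fun a ↦ (H.smooth_p a).hasFDerivAt)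
  have hinj : Function.Injective Θ'.toLinearMap := by
    refine (injective_iff_map_eq_zero _).mpr fun v hv ↦ ?_
    have hvV : v ∈ V := H.mem_of_fderiv_p hx₀ hdim fun a ↦ congrFun (congrArg Prod.snd hv) a
    exact congrArg Subtype.val ((hP ⟨v, hvV⟩).symm.trans (congrArg Prod.fst hv))
  obtain ⟨Φ, hΦ, hx₀Φ, -⟩ := hΘ.exists_openPartialHomeomorph
    (L := (Θ'.toLinearMap.linearEquivOfInjective hinj (by simp [hdim])).toContinuousLinearEquiv)
    (hΘ'.congr_fderiv rfl)
  have hPx₀ : V.subtypeL.comp P x₀ = x₀ := congrArg Subtype.val (hP ⟨x₀, hx₀⟩)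
  have hlim : Tendsto (fun x ↦ (P x : E)) (𝓝 x₀) (𝓝 x₀) :=
    (V.subtypeL.comp P).continuous.tendsto' x₀ x₀ hPx₀
  have hsource := Φ.open_source.mem_nhds hx₀Φ
  filter_upwards [hsource, hlim.eventually hsource,
    hlim.eventually (eventually_all.mpr H.vanish_p)] with x hx hPx hpP hpx
  have hxP : x = P x := Φ.injOn hx hPx (by
    rw [hΦ]
    exact Prod.ext (hP (P x)).symm (funext fun a ↦ (hpx a).trans (hpP a (P x).2).symm))
  exact hxP ▸ (P x).2

end Finite

variable {j : ℕ} {q p : Fin j → E → ℝ}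

theorem cons (H : IsCanonicalSystem B V x₀ q p) (hB : IsPoissonNear B x₀) {Q P : E → ℝ}
    (hQ : SmoothNear Q x₀) (hP : SmoothNear P x₀) (hqQ : ∀ a, PoissonCommute B x₀ (q a) Q)
    (hpQ : ∀ a, PoissonCommute B x₀ (p a) Q) (hqP : ∀ a, PoissonCommute B x₀ (q a) P)
    (hpP : ∀ a, PoissonCommute B x₀ (p a) P) (hQP : ∀ᶠ x in 𝓝 x₀, localBracket B Q P x = 1)
    (hPV : ∀ᶠ x in 𝓝 x₀, x ∈ V → P x = 0) :
    IsCanonicalSystem (ι := Fin (j + 1)) B V x₀ (Fin.cons Q q) (Fin.cons P p) where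
  smooth_q := Fin.forall_fin_succ.mpr ⟨hQ, H.smooth_q⟩
  smooth_p := Fin.forall_fin_succ.mpr ⟨hP, H.smooth_p⟩
  commute_qq := Fin.forall_fin_succ.mpr ⟨Fin.forall_fin_succ.mpr ⟨hB.commute_self Q,
    fun b ↦ hB.commute_symm (hqQ b)⟩, fun a ↦ Fin.forall_fin_succ.mpr ⟨hqQ a, H.commute_qq a⟩⟩
  commute_pp := Fin.forall_fin_succ.mpr ⟨Fin.forall_fin_succ.mpr ⟨hB.commute_self P,
    fun b ↦ hB.commute_symm (hpP b)⟩, fun a ↦ Fin.forall_fin_succ.mpr ⟨hpP a, H.commute_pp a⟩⟩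
  commute_qp {a b} hab := by
    cases a using Fin.cases <;> cases b using Fin.cases
    · exact absurd rfl hab
    · exact hB.commute_symm (hpQ _)
    · exact hqP _
    · exact H.commute_qp fun h ↦ hab (congrArg Fin.succ h)
  bracket_qp := Fin.forall_fin_succ.mpr ⟨hQP, H.bracket_qp⟩
  vanish_p := Fin.forall_fin_succ.mpr ⟨hPV, H.vanish_p⟩

end IsCanonicalSystem

theorem exists_isCanonicalSystem [FiniteDimensional ℝ E] (hB : IsPoissonNear B x₀)
    (hV : IsCoisotropicNear B V x₀) (hx₀ : x₀ ∈ V)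
    (hrank : ∀ α : E →L[ℝ] ℝ, (∀ v ∈ V, α v = 0) → (∀ β, B x₀ α β = 0) → α = 0) (j : ℕ)
    (hj : Module.finrank ℝ V + j ≤ Module.finrank ℝ E) :
    ∃ q p : Fin j → E → ℝ, IsCanonicalSystem B V x₀ q p := by
  induction j with
  | zero => exact ⟨Fin.elim0, Fin.elim0, by constructor <;> exact fun {a} ↦ a.elim0⟩
  | succ j ih =>
    obtain ⟨q, p, H⟩ := ih (by omega)
    obtain ⟨P, hP, hqP, hpP, hPV, hdP⟩ :=
      H.exists_new_momentum hB hV hx₀ (by rwa [Fintype.card_fin])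
    obtain ⟨β, hβ⟩ : ∃ β, B x₀ (fderiv ℝ P x₀) β ≠ 0 := by
      by_contra! hcon
      exact hdP (hrank _ (fun v hv ↦
        fderiv_apply_eq_zero_of_eventually_mem hP.differentiableAt hPV hx₀ hv) hcon)
    obtain ⟨h, hh, hqh, hph, hne⟩ := H.exists_transverse hB hV hx₀ hqP hpP hβ
    obtain ⟨Q, hQ, hQP, hKQ⟩ := hB.exists_conjugate hP hh hne
    exact ⟨_, _, H.cons hB hQ hP (fun a ↦ hKQ _ (H.smooth_q a) (hqP a) (hqh a))
      (fun a ↦ hKQ _ (H.smooth_p a) (hpP a) (hph a)) hqP hpP hQP hPV⟩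

end CanonicalSystem

section Coordinates

variable {E : Type*} [NormedAddCommGroup E] [NormedSpace ℝ E] {x₀ : E} {ι κ : Type*}

theorem differentialSpan_sumElim (u : ι → E → ℝ) (v : κ → E → ℝ) :
    differentialSpan x₀ (Sum.elim u v) = differentialSpan x₀ u ⊔ differentialSpan x₀ v := by
  rw [differentialSpan, differentialSpan, differentialSpan, ← Submodule.span_union,
    ← Sum.elim_range]
  congr with (a | a) <;> rfl

theorem eq_zero_of_differentialSpan_eq_top [FiniteDimensional ℝ E] {u : ι → E → ℝ}
    (hu : differentialSpan x₀ u = ⊤) {v : E} (hv : ∀ a, fderiv ℝ (u a) x₀ v = 0) : v = 0 := by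
  have hle : differentialSpan x₀ u ≤
      LinearMap.ker (ContinuousLinearMap.apply ℝ ℝ v).toLinearMap := by
    rw [differentialSpan, Submodule.span_le]
    rintro _ ⟨a, rfl⟩
    exact hv a
  rw [hu, top_le_iff] at hle
  have hv0 (α : E →L[ℝ] ℝ) : α v = 0 := by
    have hα : α ∈ LinearMap.ker (ContinuousLinearMap.apply ℝ ℝ v).toLinearMap :=
      hle ▸ Submodule.mem_top
    exact hα
  simpa using mem_of_forall_annihilator (V := ⊥) fun α _ ↦ hv0 α

theorem fderiv_euclidean_apply [Finite ι] {f : E → EuclideanSpace ℝ ι} {x : E}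
    (hf : DifferentiableAt ℝ f x) (v : E) (a : ι) :
    fderiv ℝ f x v a = fderiv ℝ (fun y ↦ f y a) x v := by
  have := Fintype.ofFinite ι
  exact (DFunLike.congr_fun ((EuclideanSpace.proj a : EuclideanSpace ℝ ι →L[ℝ] ℝ).hasFDerivAt.comp x
    hf.hasFDerivAt).fderiv v).symm

variable [Fintype ι]

theorem exists_chart_of_differentialSpan_eq_top [FiniteDimensional ℝ E] {u : ι → E → ℝ}
    (hu : ∀ a, SmoothNear (u a) x₀) (hspan : differentialSpan x₀ u = ⊤)
    (hcard : Module.finrank ℝ E = Fintype.card ι) :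
    ∃ e : OpenPartialHomeomorph E (EuclideanSpace ℝ ι), x₀ ∈ e.source ∧
      (u = fun a x ↦ e x a) ∧ ContDiffOn ℝ ∞ e e.source ∧ ContDiffOn ℝ ∞ e.symm e.target := by
  have : CompleteSpace E := FiniteDimensional.complete ℝ E
  let Ψ (x : E) : EuclideanSpace ℝ ι := WithLp.toLp 2 fun a ↦ u a x
  have hΨ : SmoothNear Ψ x₀ :=
    (eventually_all.mpr hu).mono fun x hx ↦ contDiffAt_euclidean.mpr hx
  let Ψ' : E →L[ℝ] EuclideanSpace ℝ ι :=
    (EuclideanSpace.equiv ι ℝ).symm.toContinuousLinearMap.comp (.pi fun a ↦ fderiv ℝ (u a) x₀)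
  have hΨ' : HasFDerivAt Ψ Ψ' x₀ :=
    (hasStrictFDerivAt_euclidean.mpr fun a ↦
      (hu a).contDiffAt.hasStrictFDerivAt (by simp)).hasFDerivAt
  have hinj : Function.Injective Ψ'.toLinearMap :=
    (injective_iff_map_eq_zero _).mpr fun v hv ↦ eq_zero_of_differentialSpan_eq_top hspan
      fun a ↦ congrArg (fun z : EuclideanSpace ℝ ι ↦ z a) hv
  obtain ⟨e, he, hx₀, hes, het⟩ := hΨ.exists_openPartialHomeomorph
    (L := (Ψ'.toLinearMap.linearEquivOfInjective hinj (by simp [hcard])).toContinuousLinearEquiv)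
    (hΨ'.congr_fderiv rfl)
  exact ⟨e, hx₀, by rw [he], by rwa [he], het⟩

/-- The coordinate vector `∂_a` of the coordinate system `e` at the point with coordinates `z`. -/
def frameVec [DecidableEq ι] (e : OpenPartialHomeomorph E (EuclideanSpace ℝ ι)) (a : ι)
    (z : EuclideanSpace ℝ ι) : E :=
  fderiv ℝ e.symm z (EuclideanSpace.single a (1 : ℝ))

variable {e : OpenPartialHomeomorph E (EuclideanSpace ℝ ι)}

theorem eq_sum_frameVec [DecidableEq ι] (he : ContDiffOn ℝ ∞ e e.source)
    (he' : ContDiffOn ℝ ∞ e.symm e.target) {x : E} (hx : x ∈ e.source) (v : E) :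
    v = ∑ a, fderiv ℝ (fun y ↦ e y a) x v • frameVec e a (e x) := by
  have hex := e.map_source hx
  have hd : DifferentiableAt ℝ e x :=
    (SmoothNear.of_contDiffOn e.open_source hx he).differentiableAt
  have hd' : DifferentiableAt ℝ e.symm (e x) :=
    (SmoothNear.of_contDiffOn e.open_target hex he').differentiableAt
  have hv := fderiv_apply_fderiv_symm_apply (Φ := e.symm) hex hd'
    (by rwa [e.symm_symm, e.left_inv hx]) v
  rw [e.symm_symm, e.left_inv hx] at hv
  conv_lhs => rw [← hv, ← (EuclideanSpace.basisFun ι ℝ).sum_repr (fderiv ℝ e x v), map_sum]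
  simp [frameVec, fderiv_euclidean_apply hd]

end Coordinates

section YPart

variable {k l : ℕ}

theorem continuous_yPart : Continuous (yPart : CoordSpace k l → EuclideanSpace ℝ (Fin l)) := by
  unfold yPart
  fun_prop

theorem exists_smooth_yPart {g : CoordSpace k l → ℝ} {z₀ : CoordSpace k l} (hg : SmoothNear g z₀)
    (hq : ∀ᶠ z in 𝓝 z₀, ∀ I, fderiv ℝ g z (EuclideanSpace.single (iq I) 1) = 0)
    (hp : ∀ᶠ z in 𝓝 z₀, ∀ I, fderiv ℝ g z (EuclideanSpace.single (ip I) 1) = 0) :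
    ∃ φ : EuclideanSpace ℝ (Fin l) → ℝ, ContDiff ℝ ∞ φ ∧ ∀ᶠ z in 𝓝 z₀, g z = φ (yPart z) := by
  let σ (y : EuclideanSpace ℝ (Fin l)) : CoordSpace k l :=
    WithLp.toLp 2 (Sum.elim (fun I ↦ z₀ (iq I)) (Sum.elim (fun I ↦ z₀ (ip I)) y))
  have hσ : ContDiff ℝ ∞ σ := by
    refine contDiff_euclidean.mpr ?_
    rintro (I | I | j)
    exacts [contDiff_const, contDiff_const, (EuclideanSpace.proj (𝕜 := ℝ) j).contDiff]
  have hσ₀ : σ (yPart z₀) = z₀ := by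
    ext (I | I | j) <;> rfl
  have hσy : Tendsto (fun z ↦ σ (yPart z)) (𝓝 z₀) (𝓝 z₀) :=
    (hσ.continuous.comp continuous_yPart).tendsto' z₀ z₀ hσ₀
  obtain ⟨φ, hφ, hφg⟩ :=
    (SmoothNear.comp (g := g) (by rwa [hσ₀]) (.of_contDiff hσ)).exists_contDiff
  refine ⟨φ, hφ, ?_⟩
  obtain ⟨r, hr, hball⟩ := Metric.eventually_nhds_iff_ball.mp (hg.and (hq.and hp))
  have hr' := Metric.ball_mem_nhds z₀ hr
  filter_upwards [hr', hσy.eventually hr', (continuous_yPart.tendsto z₀).eventually hφg]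
    with z hz hσz hφz
  rw [hφz]
  refine eq_of_fderiv_sub_eq_zero (convex_ball z₀ r)
    (fun w hw ↦ (hball w hw).1.differentiableAt (by simp)) hz hσz fun w hw ↦ ?_
  obtain ⟨-, hqw, hpw⟩ := hball w hw
  rw [← (EuclideanSpace.basisFun _ ℝ).sum_repr (σ (yPart z) - z), map_sum, Fintype.sum_sum_type,
    Fintype.sum_sum_type]
  simp [hqw, hpw, σ, yPart]

end YPart

section CanonicalCoframe

variable {E : Type*} [NormedAddCommGroup E] [NormedSpace ℝ E] {k l : ℕ}

/-- The bilinear form `b` on covectors is in canonical form on the covectors `θ a`. -/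
structure IsCanonicalCoframe (b : (E →L[ℝ] ℝ) →L[ℝ] (E →L[ℝ] ℝ) →L[ℝ] ℝ)
    (θ : Fin k ⊕ Fin k ⊕ Fin l → E →L[ℝ] ℝ) : Prop where
  skew (α β : E →L[ℝ] ℝ) : b α β = -b β α
  qq (I J : Fin k) : b (θ (iq I)) (θ (iq J)) = 0
  pp (I J : Fin k) : b (θ (ip I)) (θ (ip J)) = 0
  qp (I J : Fin k) : b (θ (iq I)) (θ (ip J)) = if I = J then 1 else 0
  qy (I : Fin k) (j : Fin l) : b (θ (iq I)) (θ (iy j)) = 0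
  py (I : Fin k) (j : Fin l) : b (θ (ip I)) (θ (iy j)) = 0

theorem sum_sum_mul_eq_sum_sum_half {l : ℕ} {c : Fin l → Fin l → ℝ} (hc : ∀ i j, c i j = -c j i)
    (x y : Fin l → ℝ) :
    ∑ i, ∑ j, x i * (y j * c i j) = ∑ i, ∑ j, c i j / 2 * (x i * y j - x j * y i) := by
  have hswap : ∑ i, ∑ j, c i j / 2 * (x j * y i) = -∑ i, ∑ j, c i j / 2 * (x i * y j) := by
    rw [Finset.sum_comm]
    simp only [← Finset.sum_neg_distrib]
    refine Finset.sum_congr rfl fun i _ ↦ Finset.sum_congr rfl fun j _ ↦ ?_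
    rw [hc j i]
    ring
  simp only [mul_sub, Finset.sum_sub_distrib]
  rw [hswap, sub_neg_eq_add, ← two_mul, Finset.mul_sum]
  refine Finset.sum_congr rfl fun i _ ↦ ?_
  rw [Finset.mul_sum]
  exact Finset.sum_congr rfl fun j _ ↦ by ring

variable {b : (E →L[ℝ] ℝ) →L[ℝ] (E →L[ℝ] ℝ) →L[ℝ] ℝ} {θ : Fin k ⊕ Fin k ⊕ Fin l → E →L[ℝ] ℝ}
  {D : Fin k ⊕ Fin k ⊕ Fin l → E}

theorem eq_sum_dual_frame {ι : Type*} [Fintype ι] {θ : ι → E →L[ℝ] ℝ} {D : ι → E}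
    (hD : ∀ v, v = ∑ a, θ a v • D a) (γ : E →L[ℝ] ℝ) : γ = ∑ a, γ (D a) • θ a := by
  ext v
  conv_lhs => rw [hD v, map_sum]
  simp [mul_comm]

namespace IsCanonicalCoframe

theorem pq (h : IsCanonicalCoframe b θ) (I J : Fin k) :
    b (θ (ip I)) (θ (iq J)) = if I = J then -1 else 0 := by
  rw [h.skew, h.qp]
  simp only [eq_comm (a := J), neg_ite, neg_zero]

theorem yq (h : IsCanonicalCoframe b θ) (j : Fin l) (I : Fin k) :
    b (θ (iy j)) (θ (iq I)) = 0 := by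
  rw [h.skew, h.qy, neg_zero]

theorem yp (h : IsCanonicalCoframe b θ) (j : Fin l) (I : Fin k) :
    b (θ (iy j)) (θ (ip I)) = 0 := by
  rw [h.skew, h.py, neg_zero]

theorem apply_q (h : IsCanonicalCoframe b θ) (hD : ∀ v, v = ∑ a, θ a v • D a) (I : Fin k)
    (γ : E →L[ℝ] ℝ) : b (θ (iq I)) γ = γ (D (ip I)) := by
  conv_lhs => rw [eq_sum_dual_frame hD γ]
  simp [h.qq, h.qp, h.qy]

theorem apply_p (h : IsCanonicalCoframe b θ) (hD : ∀ v, v = ∑ a, θ a v • D a) (I : Fin k)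
    (γ : E →L[ℝ] ℝ) : b (θ (ip I)) γ = -γ (D (iq I)) := by
  conv_lhs => rw [eq_sum_dual_frame hD γ]
  simp [h.pp, h.pq, h.py]

theorem apply_y (h : IsCanonicalCoframe b θ) (hD : ∀ v, v = ∑ a, θ a v • D a) (i : Fin l)
    (γ : E →L[ℝ] ℝ) : b (θ (iy i)) γ = ∑ j, γ (D (iy j)) * b (θ (iy i)) (θ (iy j)) := by
  conv_lhs => rw [eq_sum_dual_frame hD γ]
  simp [h.yq, h.yp]

theorem apply_eq_sum (h : IsCanonicalCoframe b θ) (hD : ∀ v, v = ∑ a, θ a v • D a)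
    (α β : E →L[ℝ] ℝ) :
    b α β = (∑ I : Fin k, (α (D (iq I)) * β (D (ip I)) - α (D (ip I)) * β (D (iq I)))) +
      ∑ i : Fin l, ∑ j : Fin l, b (θ (iy i)) (θ (iy j)) / 2 *
        (α (D (iy i)) * β (D (iy j)) - α (D (iy j)) * β (D (iy i))) := by
  rw [← sum_sum_mul_eq_sum_sum_half fun i j ↦ h.skew _ _]
  conv_lhs => rw [eq_sum_dual_frame hD α]
  simp only [map_sum, map_smul, _root_.sum_apply, _root_.smul_apply, smul_eq_mul]
  simp only [Fintype.sum_sum_type, h.apply_q hD, h.apply_p hD, h.apply_y hD _ β,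
    Finset.mul_sum, mul_neg, Finset.sum_neg_distrib, Finset.sum_add_distrib, sub_eq_add_neg]
  exact (add_assoc _ _ _).symm

end IsCanonicalCoframe

end CanonicalCoframe

section CanonicalFrame

variable {E : Type*} [NormedAddCommGroup E] [NormedSpace ℝ E]
  {B : E → (E →L[ℝ] ℝ) →L[ℝ] (E →L[ℝ] ℝ) →L[ℝ] ℝ} {V : Submodule ℝ E} {x₀ : E} {k l : ℕ}

/-- A canonical system completed by functions that commute with it, the differentials of all these
functions spanning the cotangent space at `x₀`. -/
structure IsCanonicalFrame (B : E → (E →L[ℝ] ℝ) →L[ℝ] (E →L[ℝ] ℝ) →L[ℝ] ℝ) (V : Submodule ℝ E)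
    (x₀ : E) (u : Fin k ⊕ Fin k ⊕ Fin l → E → ℝ) : Prop where
  isCanonicalSystem : IsCanonicalSystem B V x₀ (fun I ↦ u (iq I)) fun I ↦ u (ip I)
  smooth_y (j : Fin l) : SmoothNear (u (iy j)) x₀
  commute_qy (I : Fin k) (j : Fin l) : PoissonCommute B x₀ (u (iq I)) (u (iy j))
  commute_py (I : Fin k) (j : Fin l) : PoissonCommute B x₀ (u (ip I)) (u (iy j))
  span_eq_top : differentialSpan x₀ u = ⊤

namespace IsCanonicalFrame

variable {u : Fin k ⊕ Fin k ⊕ Fin l → E → ℝ}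

theorem smooth (H : IsCanonicalFrame B V x₀ u) : ∀ a, SmoothNear (u a) x₀
  | .inl I => H.isCanonicalSystem.smooth_q I
  | .inr (.inl I) => H.isCanonicalSystem.smooth_p I
  | .inr (.inr j) => H.smooth_y j

theorem isCanonicalCoframe (H : IsCanonicalFrame B V x₀ u) (hB : IsPoissonNear B x₀) :
    ∀ᶠ x in 𝓝 x₀, IsCanonicalCoframe (B x) fun a ↦ fderiv ℝ (u a) x := by
  have S := H.isCanonicalSystem
  have hqp (I J : Fin k) : ∀ᶠ x in 𝓝 x₀,
      localBracket B (u (iq I)) (u (ip J)) x = if I = J then 1 else 0 := by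
    split_ifs with hIJ
    exacts [hIJ ▸ S.bracket_qp I, S.commute_qp hIJ]
  filter_upwards [hB.skew, eventually_all.mpr fun I ↦ eventually_all.mpr (S.commute_qq I),
    eventually_all.mpr fun I ↦ eventually_all.mpr (S.commute_pp I),
    eventually_all.mpr fun I ↦ eventually_all.mpr (hqp I),
    eventually_all.mpr fun I ↦ eventually_all.mpr (H.commute_qy I),
    eventually_all.mpr fun I ↦ eventually_all.mpr (H.commute_py I)]
    with x hskew hqq hpp hqp hqy hpy
  exact ⟨hskew, hqq, hpp, hqp, hqy, hpy⟩

theorem commute_bracket_yy (H : IsCanonicalFrame B V x₀ u) (hB : IsPoissonNear B x₀)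
    {a : Fin k ⊕ Fin k ⊕ Fin l} (ha : ∀ j, PoissonCommute B x₀ (u a) (u (iy j))) (i j : Fin l) :
    PoissonCommute B x₀ (u a) (localBracket B (u (iy i)) (u (iy j))) := by
  filter_upwards [hB.bracket_left_comm (H.smooth a) (H.smooth_y i) (H.smooth_y j) (ha i),
    (ha j).eventually_nhds] with x hcomm hj
  rw [hcomm, localBracket_eq_zero_of_eventually_const hj]

theorem exists_eq_comp_yPart {e : OpenPartialHomeomorph E (CoordSpace k l)}
    (H : IsCanonicalFrame B V x₀ fun a x ↦ e x a) (hB : IsPoissonNear B x₀)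
    (he : ContDiffOn ℝ ∞ e e.source) (he' : ContDiffOn ℝ ∞ e.symm e.target) (hx₀ : x₀ ∈ e.source)
    {G : E → ℝ} (hG : SmoothNear G x₀) (hqG : ∀ I, PoissonCommute B x₀ (fun x ↦ e x (iq I)) G)
    (hpG : ∀ I, PoissonCommute B x₀ (fun x ↦ e x (ip I)) G) :
    ∃ φ : EuclideanSpace ℝ (Fin l) → ℝ, ContDiff ℝ ∞ φ ∧ ∀ᶠ x in 𝓝 x₀, G x = φ (yPart (e x)) := by
  have hz₀ := e.map_source hx₀
  have hinv : e.symm (e x₀) = x₀ := e.left_inv hx₀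
  have hlim : Tendsto e.symm (𝓝 (e x₀)) (𝓝 x₀) := by
    simpa only [hinv] using (e.continuousAt_symm hz₀).tendsto
  have hsymm : SmoothNear e.symm (e x₀) := .of_contDiffOn e.open_target hz₀ he'
  have hpartial : ∀ᶠ z in 𝓝 (e x₀), ∀ a, fderiv ℝ (fun z ↦ G (e.symm z)) z
      (EuclideanSpace.single a 1) = fderiv ℝ G (e.symm z) (frameVec e a z) := by
    filter_upwards [hlim.eventually hG.eventually, hsymm.eventually] with z hGz hz a
    exact SmoothNear.fderiv_comp_apply hGz hz _
  have hcoframe := hlim.eventually (H.isCanonicalCoframe hB)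
  have htarget := e.open_target.mem_nhds hz₀
  have hframe {z : CoordSpace k l} (hz : z ∈ e.target) (v : E) :
      v = ∑ a, fderiv ℝ (fun x ↦ e x a) (e.symm z) v • frameVec e a z := by
    simpa only [e.right_inv hz] using eq_sum_frameVec he he' (e.map_target hz) v
  obtain ⟨φ, hφ, hφG⟩ := exists_smooth_yPart (g := fun z ↦ G (e.symm z))
    (SmoothNear.comp (by rwa [hinv]) hsymm) (by
      filter_upwards [hpartial, hcoframe, htarget, hlim.eventually (eventually_all.mpr hpG)]
        with z hd hco hz hpz I
      rw [hd, ← neg_eq_zero, ← hco.apply_p (hframe hz)]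
      exact hpz I) (by
      filter_upwards [hpartial, hcoframe, htarget, hlim.eventually (eventually_all.mpr hqG)]
        with z hd hco hz hqz I
      rw [hd, ← hco.apply_q (hframe hz)]
      exact hqz I)
  refine ⟨φ, hφ, ?_⟩
  filter_upwards [(e.continuousAt hx₀).eventually hφG, e.open_source.mem_nhds hx₀] with x hx hxe
  rwa [e.left_inv hxe] at hx

end IsCanonicalFrame

theorem IsCanonicalSystem.finrank_differentialSpan {q p : Fin k → E → ℝ}
    (H : IsCanonicalSystem B V x₀ q p) (hB : IsPoissonNear B x₀) :
    Module.finrank ℝ ↥(differentialSpan x₀ q ⊔ differentialSpan x₀ p) = k + k := by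
  have hrank := finrank_span_eq_card (H.linearIndependent hB)
  rwa [Sum.elim_range, Submodule.span_union, Fintype.card_sum, Fintype.card_fin] at hrank

theorem finrank_continuousDual [FiniteDimensional ℝ E] :
    Module.finrank ℝ (E →L[ℝ] ℝ) = Module.finrank ℝ E :=
  (LinearMap.toContinuousLinearMap : (E →ₗ[ℝ] ℝ) ≃ₗ[ℝ] (E →L[ℝ] ℝ)).finrank_eq.symm.trans
    Subspace.dual_finrank_eq

variable [FiniteDimensional ℝ E]

theorem IsCanonicalSystem.exists_frame {q p : Fin k → E → ℝ} (H : IsCanonicalSystem B V x₀ q p)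
    (hB : IsPoissonNear B x₀) (hV : IsCoisotropicNear B V x₀) (hx₀ : x₀ ∈ V)
    (hn : Module.finrank ℝ E = k + (k + l)) :
    ∃ u : Fin k ⊕ Fin k ⊕ Fin l → E → ℝ, IsCanonicalFrame B V x₀ u := by
  obtain ⟨W, hW⟩ := Submodule.exists_isCompl (differentialSpan x₀ q ⊔ differentialSpan x₀ p)
  have hWl : Module.finrank ℝ W = l := by
    have hadd := Submodule.finrank_add_eq_of_isCompl hW
    rw [H.finrank_differentialSpan hB, finrank_continuousDual] at hadd
    omega
  let b := Module.finBasisOfFinrankEq ℝ W hWl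
  choose y hy hqy hpy hdy _ using fun j ↦
    H.exists_commuting hB hV hx₀ (SmoothNear.clm (x := x₀) (b j : E →L[ℝ] ℝ))
  refine ⟨Sum.elim q (Sum.elim p y), H, hy, fun I j ↦ hqy j I, fun I j ↦ hpy j I, ?_⟩
  rw [differentialSpan_sumElim, differentialSpan_sumElim, ← sup_assoc, ← top_le_iff,
    ← hW.sup_eq_top, sup_le_iff]
  refine ⟨le_sup_left, ?_⟩
  rw [← W.map_subtype_top, ← b.span_eq, Submodule.map_span, Submodule.span_le]
  rintro _ ⟨_, ⟨j, rfl⟩, rfl⟩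
  have hdy' := hdy j
  rw [(b j : E →L[ℝ] ℝ).fderiv, ← neg_mem_iff, neg_sub] at hdy'
  simpa using Submodule.add_mem _ (Submodule.mem_sup_left hdy')
    (Submodule.mem_sup_right (fderiv_mem_differentialSpan (x₀ := x₀) y j))

theorem exists_isCanonicalFrame_chart (hB : IsPoissonNear B x₀) (hV : IsCoisotropicNear B V x₀)
    (hx₀ : x₀ ∈ V)
    (hrank : ∀ α : E →L[ℝ] ℝ, (∀ v ∈ V, α v = 0) → (∀ β, B x₀ α β = 0) → α = 0)
    (hdim : Module.finrank ℝ E = Module.finrank ℝ V + k) (hl : l = Module.finrank ℝ V - k) :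
    ∃ e : OpenPartialHomeomorph E (CoordSpace k l), x₀ ∈ e.source ∧
      IsCanonicalFrame B V x₀ (fun a x ↦ e x a) ∧
      ContDiffOn ℝ ∞ e e.source ∧ ContDiffOn ℝ ∞ e.symm e.target := by
  obtain ⟨q, p, S⟩ := exists_isCanonicalSystem hB hV hx₀ hrank k hdim.ge
  have hk : k + k ≤ Module.finrank ℝ E := by
    rw [← S.finrank_differentialSpan hB, ← finrank_continuousDual (E := E)]
    exact Submodule.finrank_le _
  have hn : Module.finrank ℝ E = k + (k + l) := by omega
  obtain ⟨u, H⟩ := S.exists_frame hB hV hx₀ hn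
  obtain ⟨e, hxe, rfl, he, he'⟩ :=
    exists_chart_of_differentialSpan_eq_top H.smooth H.span_eq_top (by simp [hn])
  exact ⟨e, hxe, H, he, he'⟩

theorem exists_canonical_chart (hB : IsPoissonNear B x₀) (hV : IsCoisotropicNear B V x₀)
    (hx₀ : x₀ ∈ V)
    (hrank : ∀ α : E →L[ℝ] ℝ, (∀ v ∈ V, α v = 0) → (∀ β, B x₀ α β = 0) → α = 0)
    (hdim : Module.finrank ℝ E = Module.finrank ℝ V + k) (hl : l = Module.finrank ℝ V - k)
    {U : Set E} (hU : U ∈ 𝓝 x₀) :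
    ∃ e : OpenPartialHomeomorph E (CoordSpace k l), x₀ ∈ e.source ∧ e.source ⊆ U ∧
      ContDiffOn ℝ ∞ e e.source ∧ ContDiffOn ℝ ∞ e.symm e.target ∧
      (∀ x ∈ e.source, x ∈ V ↔ ∀ I : Fin k, e x (ip I) = 0) ∧
      ∃ φ : Fin l → Fin l → EuclideanSpace ℝ (Fin l) → ℝ, (∀ i j, ContDiff ℝ ∞ (φ i j)) ∧
        ∀ z ∈ e.target, ∀ α β : E →L[ℝ] ℝ, B (e.symm z) α β =
          (∑ I : Fin k, (α (frameVec e (iq I) z) * β (frameVec e (ip I) z) -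
            α (frameVec e (ip I) z) * β (frameVec e (iq I) z))) +
          ∑ i : Fin l, ∑ j : Fin l, φ i j (yPart z) *
            (α (frameVec e (iy i) z) * β (frameVec e (iy j) z) -
              α (frameVec e (iy j) z) * β (frameVec e (iy i) z)) := by
  obtain ⟨e, hxe, H, he, he'⟩ := exists_isCanonicalFrame_chart hB hV hx₀ hrank hdim hl
  choose φ hφ hφG using fun i j ↦ H.exists_eq_comp_yPart hB he he' hxe
    (hB.bracket_smooth (H.smooth_y i) (H.smooth_y j))
    (fun I ↦ H.commute_bracket_yy hB (H.commute_qy I) i j)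
    (fun I ↦ H.commute_bracket_yy hB (H.commute_py I) i j)
  have hVp : ∀ᶠ x in 𝓝 x₀, x ∈ V ↔ ∀ I : Fin k, e x (ip I) = 0 := by
    filter_upwards [eventually_all.mpr H.isCanonicalSystem.vanish_p,
      H.isCanonicalSystem.eventually_mem_of_p_eq_zero hx₀ (by simpa using hdim)] with x hpx hxV
    exact ⟨fun hx I ↦ hpx I hx, hxV⟩
  obtain ⟨t, ht, htopen, hxt⟩ := eventually_nhds_iff.mp ((eventually_mem_set.mpr hU).and (hVp.and
    ((H.isCanonicalCoframe hB).and
      (eventually_all.mpr fun i ↦ eventually_all.mpr fun j ↦ hφG i j))))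
  refine ⟨e.restrOpen t htopen, ⟨hxe, hxt⟩, fun x hx ↦ (ht x hx.2).1, he.mono fun x hx ↦ hx.1,
    he'.mono fun z hz ↦ hz.1, fun x hx ↦ (ht x hx.2).2.1, fun i j y ↦ φ i j y / 2,
    fun i j ↦ (hφ i j).div_const 2, fun z hz α β ↦ ?_⟩
  obtain ⟨hz, hzt⟩ : z ∈ e.target ∧ e.symm z ∈ t := hz
  obtain ⟨-, -, hco, hyy⟩ := ht _ hzt
  have hframe := eq_sum_frameVec he he' (e.map_target hz)
  simp only [e.right_inv hz] at hframe hyy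
  simp only [← hyy]
  exact hco.apply_eq_sum hframe α β

end CanonicalFrame

section ChartBivector

variable {n : ℕ} {P : Type*} [TopologicalSpace P]
  [ChartedSpace (EuclideanSpace ℝ (Fin n)) P]
  {φ : OpenPartialHomeomorph P (EuclideanSpace ℝ (Fin n))}

theorem mdifferentiable_chart (hφ : φ ∈ IsManifold.maximalAtlas (𝓡 n) ∞ P) :
    φ.MDifferentiable (𝓡 n) 𝓘(ℝ, EuclideanSpace ℝ (Fin n)) :=
  ⟨(contMDiffOn_of_mem_maximalAtlas hφ).mdifferentiableOn (by simp),
    (contMDiffOn_symm_of_mem_maximalAtlas hφ).mdifferentiableOn (by simp)⟩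

theorem contMDiffAt_comp_chart (hφ : φ ∈ IsManifold.maximalAtlas (𝓡 n) ∞ P) {x : P}
    (hx : x ∈ φ.source) {f : EuclideanSpace ℝ (Fin n) → ℝ} (hf : ContDiffAt ℝ ∞ f (φ x)) :
    ContMDiffAt (𝓡 n) 𝓘(ℝ, ℝ) ∞ (fun y ↦ f (φ y)) x :=
  ContMDiffAt.comp x hf.contMDiffAt
    ((contMDiffOn_of_mem_maximalAtlas hφ).contMDiffAt (φ.open_source.mem_nhds hx))

theorem mvfderiv_comp_chart (hφ : φ ∈ IsManifold.maximalAtlas (𝓡 n) ∞ P) {x : P}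
    (hx : x ∈ φ.source) {f : EuclideanSpace ℝ (Fin n) → ℝ} (hf : DifferentiableAt ℝ f (φ x)) :
    mvfderiv (𝓡 n) (fun y ↦ f (φ y)) x =
      fderiv ℝ f (φ x) ∘L mfderiv (𝓡 n) 𝓘(ℝ, EuclideanSpace ℝ (Fin n)) φ x := by
  have hchain : mfderiv (𝓡 n) 𝓘(ℝ, ℝ) (f ∘ φ) x =
      (mfderiv 𝓘(ℝ, EuclideanSpace ℝ (Fin n)) 𝓘(ℝ, ℝ) f (φ x)).comp
        (mfderiv (𝓡 n) 𝓘(ℝ, EuclideanSpace ℝ (Fin n)) φ x) :=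
    mfderiv_comp x hf.mdifferentiableAt ((mdifferentiable_chart hφ).mdifferentiableAt hx)
  rwa [mfderiv_eq_fderiv] at hchain

variable [IsManifold (𝓡 n) ∞ P]

theorem contMDiffAt_differential {f : P → ℝ} {x₀ : P} (hf : ContMDiffAt (𝓡 n) 𝓘(ℝ, ℝ) ∞ f x₀) :
    ContMDiffAt (𝓡 n) ((𝓡 n).prod 𝓘(ℝ, EuclideanSpace ℝ (Fin n) →L[ℝ] ℝ)) ∞
      (fun x ↦ Bundle.TotalSpace.mk' (EuclideanSpace ℝ (Fin n) →L[ℝ] ℝ)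
        (E := fun x : P ↦ TangentSpace (𝓡 n) x →L[ℝ] Bundle.Trivial P ℝ x) x
        (mvfderiv (𝓡 n) f x)) x₀ := by
  rw [contMDiffAt_hom_bundle]
  refine ⟨contMDiffAt_id, (hf.mfderiv_const (m := ∞) (by simp)).congr_of_eventuallyEq ?_⟩
  filter_upwards with x
  ext v
  simp only [inTangentCoordinates, ContinuousLinearMap.inCoordinates, mvfderiv,
    Bundle.Trivial.fiberBundle_trivializationAt',
    Bundle.Trivial.continuousLinearMapAt_trivialization, ContinuousLinearMap.id_comp,
    ContinuousLinearMap.comp_apply, ContinuousLinearEquiv.coe_coe,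
    TangentBundle.continuousLinearMapAt_model_space, id_eq]
  rfl

theorem BivectorField.contMDiffAt_apply (B : BivectorField n P) {x₀ : P}
    {α β : ∀ x : P, Cotangent n x}
    (hα : ContMDiffAt (𝓡 n) ((𝓡 n).prod 𝓘(ℝ, EuclideanSpace ℝ (Fin n) →L[ℝ] ℝ)) ∞
      (fun x ↦ Bundle.TotalSpace.mk' (EuclideanSpace ℝ (Fin n) →L[ℝ] ℝ)
        (E := fun x : P ↦ TangentSpace (𝓡 n) x →L[ℝ] Bundle.Trivial P ℝ x) x (α x)) x₀)
    (hβ : ContMDiffAt (𝓡 n) ((𝓡 n).prod 𝓘(ℝ, EuclideanSpace ℝ (Fin n) →L[ℝ] ℝ)) ∞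
      (fun x ↦ Bundle.TotalSpace.mk' (EuclideanSpace ℝ (Fin n) →L[ℝ] ℝ)
        (E := fun x : P ↦ TangentSpace (𝓡 n) x →L[ℝ] Bundle.Trivial P ℝ x) x (β x)) x₀) :
    ContMDiffAt (𝓡 n) 𝓘(ℝ, ℝ) ∞ (fun x ↦ B.toFun x (α x) (β x)) x₀ := by
  have happly := ContMDiffAt.clm_bundle_apply₂
    (E₁ := fun x : P ↦ TangentSpace (𝓡 n) x →L[ℝ] Bundle.Trivial P ℝ x)
    (E₂ := fun x : P ↦ TangentSpace (𝓡 n) x →L[ℝ] Bundle.Trivial P ℝ x)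
    (E₃ := Bundle.Trivial P ℝ) (b := fun x : P ↦ x) (B.smooth x₀) hα hβ
  exact (Bundle.contMDiffAt_totalSpace.mp happly).2

theorem BivectorField.contMDiffAt_bracket (B : BivectorField n P) {f g : P → ℝ} {x₀ : P}
    (hf : ContMDiffAt (𝓡 n) 𝓘(ℝ, ℝ) ∞ f x₀) (hg : ContMDiffAt (𝓡 n) 𝓘(ℝ, ℝ) ∞ g x₀) :
    ContMDiffAt (𝓡 n) 𝓘(ℝ, ℝ) ∞ (B.bracket f g) x₀ :=
  B.contMDiffAt_apply (contMDiffAt_differential hf) (contMDiffAt_differential hg)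

/-- The local representation of a bivector field in a chart `φ`, a bilinear form on covectors of the
model space at each point; outside the target of `φ` the values are junk. -/
def BivectorField.inChart (B : BivectorField n P)
    (φ : OpenPartialHomeomorph P (EuclideanSpace ℝ (Fin n))) (z : EuclideanSpace ℝ (Fin n)) :
    (EuclideanSpace ℝ (Fin n) →L[ℝ] ℝ) →L[ℝ] (EuclideanSpace ℝ (Fin n) →L[ℝ] ℝ) →L[ℝ] ℝ :=
  let D : EuclideanSpace ℝ (Fin n) →L[ℝ] EuclideanSpace ℝ (Fin n) :=
    mfderiv (𝓡 n) 𝓘(ℝ, EuclideanSpace ℝ (Fin n)) φ (φ.symm z)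
  let b : (EuclideanSpace ℝ (Fin n) →L[ℝ] ℝ) →L[ℝ] (EuclideanSpace ℝ (Fin n) →L[ℝ] ℝ) →L[ℝ] ℝ :=
    B.toFun (φ.symm z)
  b.bilinearComp (ContinuousLinearMap.precomp ℝ D) (ContinuousLinearMap.precomp ℝ D)

theorem BivectorField.inChart_apply (B : BivectorField n P) (z : EuclideanSpace ℝ (Fin n))
    (α β : EuclideanSpace ℝ (Fin n) →L[ℝ] ℝ) :
    B.inChart φ z α β = B.toFun (φ.symm z)
      (α ∘L mfderiv (𝓡 n) 𝓘(ℝ, EuclideanSpace ℝ (Fin n)) φ (φ.symm z))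
      (β ∘L mfderiv (𝓡 n) 𝓘(ℝ, EuclideanSpace ℝ (Fin n)) φ (φ.symm z)) := rfl

theorem BivectorField.localBracket_inChart (B : BivectorField n P)
    (hφ : φ ∈ IsManifold.maximalAtlas (𝓡 n) ∞ P) {x : P} (hx : x ∈ φ.source)
    {f g : EuclideanSpace ℝ (Fin n) → ℝ} (hf : DifferentiableAt ℝ f (φ x))
    (hg : DifferentiableAt ℝ g (φ x)) :
    B.bracket (fun y ↦ f (φ y)) (fun y ↦ g (φ y)) x = localBracket (B.inChart φ) f g (φ x) := by
  rw [localBracket, B.inChart_apply, φ.left_inv hx, BivectorField.bracket,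
    mvfderiv_comp_chart hφ hx hf, mvfderiv_comp_chart hφ hx hg]

theorem BivectorField.inChart_smooth (B : BivectorField n P)
    (hφ : φ ∈ IsManifold.maximalAtlas (𝓡 n) ∞ P) {z₀ : EuclideanSpace ℝ (Fin n)}
    (hz₀ : z₀ ∈ φ.target) : SmoothNear (B.inChart φ) z₀ := by
  refine .of_contDiffOn φ.open_target hz₀ ?_
  refine contDiffOn_clm_apply.mpr fun α ↦ contDiffOn_clm_apply.mpr fun β ↦ fun z hz ↦ ?_
  have hx := φ.map_target hz
  have hbracket : ContMDiffAt (𝓡 n) 𝓘(ℝ, ℝ) ∞ (B.bracket (fun y ↦ α (φ y)) (fun y ↦ β (φ y)))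
      (φ.symm z) := B.contMDiffAt_bracket
    (contMDiffAt_comp_chart hφ hx α.contDiff.contDiffAt)
    (contMDiffAt_comp_chart hφ hx β.contDiff.contDiffAt)
  have hcomp : ContMDiffAt 𝓘(ℝ, EuclideanSpace ℝ (Fin n)) 𝓘(ℝ, ℝ) ∞
      (fun w ↦ B.bracket (fun y ↦ α (φ y)) (fun y ↦ β (φ y)) (φ.symm w)) z :=
    ContMDiffAt.comp z hbracket
      ((contMDiffOn_symm_of_mem_maximalAtlas hφ).contMDiffAt (φ.open_target.mem_nhds hz))
  refine (hcomp.contDiffAt.congr_of_eventuallyEq ?_).contDiffWithinAt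
  filter_upwards [φ.open_target.mem_nhds hz] with w hw
  rw [B.localBracket_inChart hφ (φ.map_target hw) α.differentiableAt β.differentiableAt,
    φ.right_inv hw, localBracket, α.fderiv, β.fderiv]

theorem BivectorField.localBracket_localBracket_inChart (B : BivectorField n P)
    (hφ : φ ∈ IsManifold.maximalAtlas (𝓡 n) ∞ P) {x : P} (hx : x ∈ φ.source)
    {f g h : EuclideanSpace ℝ (Fin n) → ℝ} (hf : SmoothNear f (φ x)) (hg : SmoothNear g (φ x))
    (hh : SmoothNear h (φ x)) :
    B.bracket (fun y ↦ f (φ y)) (B.bracket (fun y ↦ g (φ y)) (fun y ↦ h (φ y))) x =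
      localBracket (B.inChart φ) f (localBracket (B.inChart φ) g h) (φ x) := by
  have hgh : SmoothNear (localBracket (B.inChart φ) g h) (φ x) :=
    ((B.inChart_smooth hφ (φ.map_source hx)).clm_apply hg.fderiv).clm_apply hh.fderiv
  have hev : B.bracket (fun y ↦ g (φ y)) (fun y ↦ h (φ y)) =ᶠ[𝓝 x]
      fun y ↦ localBracket (B.inChart φ) g h (φ y) := by
    filter_upwards [φ.open_source.mem_nhds hx,
      (φ.continuousAt hx).eventually hg, (φ.continuousAt hx).eventually hh] with y hy hgy hhy
    exact B.localBracket_inChart hφ hy (hgy.differentiableAt (by simp))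
      (hhy.differentiableAt (by simp))
  rw [← B.localBracket_inChart hφ hx hf.differentiableAt hgh.differentiableAt,
    BivectorField.bracket, BivectorField.bracket]
  congr 1
  exact hev.mfderiv_eq

theorem BivectorField.isPoissonNear_inChart (B : BivectorField n P) (hB : B.IsPoisson)
    (hφ : φ ∈ IsManifold.maximalAtlas (𝓡 n) ∞ P) {z₀ : EuclideanSpace ℝ (Fin n)}
    (hz₀ : z₀ ∈ φ.target) : IsPoissonNear (B.inChart φ) z₀ where
  smooth := B.inChart_smooth hφ hz₀
  skew := Eventually.of_forall fun z α β ↦ by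
    rw [B.inChart_apply, B.inChart_apply]
    exact B.skew _ _ _
  jacobi := by
    filter_upwards [φ.open_target.mem_nhds hz₀] with z hz f g h hf hg hh
    obtain ⟨W, hW, hWo, hzW⟩ := eventually_nhds_iff.mp (hf.and (hg.and hh))
    obtain ⟨x, hx, rfl⟩ : ∃ x ∈ φ.source, φ x = z := ⟨φ.symm z, φ.map_target hz, φ.right_inv hz⟩
    have hzero := hB _ (φ.isOpen_inter_preimage hWo) (fun y ↦ f (φ y)) (fun y ↦ g (φ y))
      (fun y ↦ h (φ y))
      (fun y hy ↦ (contMDiffAt_comp_chart hφ hy.1 (hW _ hy.2).1).contMDiffWithinAt)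
      (fun y hy ↦ (contMDiffAt_comp_chart hφ hy.1 (hW _ hy.2).2.1).contMDiffWithinAt)
      (fun y hy ↦ (contMDiffAt_comp_chart hφ hy.1 (hW _ hy.2).2.2).contMDiffWithinAt) x ⟨hx, hzW⟩
    rw [BivectorField.schoutenSquare, B.localBracket_localBracket_inChart hφ hx hf hg hh,
      B.localBracket_localBracket_inChart hφ hx hg hh hf,
      B.localBracket_localBracket_inChart hφ hx hh hf hg] at hzero
    linarith

end ChartBivector

section Slice

variable {n m : ℕ} {P : Type*} [TopologicalSpace P]
  [ChartedSpace (EuclideanSpace ℝ (Fin n)) P]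
  {M : Type*} [TopologicalSpace M] [ChartedSpace (EuclideanSpace ℝ (Fin m)) M]
  {φ : OpenPartialHomeomorph P (EuclideanSpace ℝ (Fin n))}
  {ψ : OpenPartialHomeomorph M (EuclideanSpace ℝ (Fin m))} {i : M → P}
  {J : EuclideanSpace ℝ (Fin m) →L[ℝ] EuclideanSpace ℝ (Fin n)}

/-- The chart `φ` carries the tangent space of the submanifold `i` at `i y` to the linear
subspace `V`. -/
structure IsTangentChartAt (φ : OpenPartialHomeomorph P (EuclideanSpace ℝ (Fin n)))
    (V : Submodule ℝ (EuclideanSpace ℝ (Fin n))) (i : M → P) (y : M) : Prop where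
  mem_source : i y ∈ φ.source
  mem_iff (v : EuclideanSpace ℝ (Fin n)) : v ∈ V ↔ ∃ w ∈ tangentSub (m := m) (n := n) i y,
    mfderiv (𝓡 n) 𝓘(ℝ, EuclideanSpace ℝ (Fin n)) φ (i y) w = v

/-- Near `i x`, the chart `φ` carries the submanifold `i`, together with its tangent spaces, to the
linear subspace `V`. -/
structure IsSliceChart (φ : OpenPartialHomeomorph P (EuclideanSpace ℝ (Fin n)))
    (V : Submodule ℝ (EuclideanSpace ℝ (Fin n))) (i : M → P) (x : M) : Prop where
  mem_maximalAtlas : φ ∈ IsManifold.maximalAtlas (𝓡 n) ∞ P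
  finrank_eq : Module.finrank ℝ V = m
  isTangentChartAt : IsTangentChartAt (m := m) φ V i x
  eventually_mem_range_iff : ∀ᶠ z in 𝓝 (φ (i x)), φ.symm z ∈ range i ↔ z ∈ V
  eventually_exists_eq : ∀ᶠ z in 𝓝 (φ (i x)), z ∈ V →
    ∃ y, IsTangentChartAt (m := m) φ V i y ∧ φ (i y) = z

/-- In the charts `φ` and `ψ` the map `i` is the linear map `J`. -/
structure IsLinearInCharts (φ : OpenPartialHomeomorph P (EuclideanSpace ℝ (Fin n)))
    (ψ : OpenPartialHomeomorph M (EuclideanSpace ℝ (Fin m)))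
    (J : EuclideanSpace ℝ (Fin m) →L[ℝ] EuclideanSpace ℝ (Fin n)) (i : M → P) : Prop where
  mem_maximalAtlas : φ ∈ IsManifold.maximalAtlas (𝓡 n) ∞ P
  mem_maximalAtlas' : ψ ∈ IsManifold.maximalAtlas (𝓡 m) ∞ M
  mapsTo : MapsTo i ψ.source φ.source
  eqOn : EqOn (φ ∘ i) (J ∘ ψ) ψ.source

theorem exists_isLinearInCharts {x : M} (hi : Manifold.IsImmersionAt (𝓡 m) (𝓡 n) ∞ i x) :
    ∃ φ ψ J, IsLinearInCharts (m := m) (n := n) φ ψ J i ∧ x ∈ ψ.source ∧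
      Function.Injective J := by
  refine ⟨hi.codChart, hi.domChart,
    hi.equiv.toContinuousLinearMap ∘L ContinuousLinearMap.inl ℝ _ _,
    ⟨hi.codChart_mem_maximalAtlas, hi.domChart_mem_maximalAtlas,
      fun y hy ↦ hi.source_subset_preimage_source hy, fun y hy ↦ ?_⟩,
    hi.mem_domChart_source, fun u v huv ↦ by simpa using hi.equiv.injective huv⟩
  have hwritten := hi.writtenInCharts
    (show hi.domChart y ∈ (hi.domChart.extend (𝓡 m)).target by
      simpa using hi.domChart.map_source hy)
  simpa [hi.domChart.left_inv hy] using hwritten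

namespace IsLinearInCharts

theorem isTangentChartAt (h : IsLinearInCharts φ ψ J i) {y : M} (hy : y ∈ ψ.source)
    (hi : MDifferentiableAt (𝓡 m) (𝓡 n) i y) :
    IsTangentChartAt (m := m) φ (LinearMap.range J.toLinearMap) i y := by
  have hφi := mfderiv_comp y
    ((mdifferentiable_chart h.mem_maximalAtlas).mdifferentiableAt (h.mapsTo hy)) hi
  have hJψ := mfderiv_comp (I' := 𝓘(ℝ, EuclideanSpace ℝ (Fin m))) y
    (J.differentiableAt.mdifferentiableAt (x := ψ y))
    ((mdifferentiable_chart h.mem_maximalAtlas').mdifferentiableAt hy)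
  rw [mfderiv_eq_fderiv, J.fderiv] at hJψ
  have hderiv := (h.eqOn.eventuallyEq_of_mem (ψ.open_source.mem_nhds hy)).mfderiv_eq
    (I := 𝓡 m) (I' := 𝓘(ℝ, EuclideanSpace ℝ (Fin n)))
  rw [hφi, hJψ] at hderiv
  refine ⟨h.mapsTo hy, fun v ↦ ⟨?_, ?_⟩⟩
  · rintro ⟨u, rfl⟩
    obtain ⟨w, rfl⟩ := (mdifferentiable_chart h.mem_maximalAtlas').mfderiv_surjective hy u
    exact ⟨_, ⟨w, rfl⟩, DFunLike.congr_fun hderiv w⟩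
  · rintro ⟨_, ⟨w, rfl⟩, rfl⟩
    exact ⟨_, (DFunLike.congr_fun hderiv w).symm⟩

theorem eventually_exists_eq (h : IsLinearInCharts φ ψ J i) (hJ : Function.Injective J) {x : M}
    (hx : x ∈ ψ.source) :
    ∀ᶠ z in 𝓝 (φ (i x)), z ∈ LinearMap.range J.toLinearMap → ∃ y ∈ ψ.source, φ (i y) = z := by
  have htarget := ψ.open_target.mem_nhds (ψ.map_source hx)
  rw [(LinearMap.isClosedEmbedding_of_injective (LinearMap.ker_eq_bot.mpr
    hJ : LinearMap.ker J.toLinearMap = ⊥)).isInducing.nhds_eq_comap, mem_comap] at htarget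
  obtain ⟨t, ht, htJ⟩ := htarget
  have hφx : φ (i x) = J (ψ x) := h.eqOn hx
  rw [hφx]
  filter_upwards [ht] with z hz
  rintro ⟨u, rfl⟩
  have hu : u ∈ ψ.target := htJ hz
  exact ⟨ψ.symm u, ψ.map_target hu, (h.eqOn (ψ.map_target hu)).trans (by simp [ψ.right_inv hu])⟩

theorem eventually_mem_range_iff (h : IsLinearInCharts φ ψ J i) (hJ : Function.Injective J)
    (hi : IsInducing i) {x : M} (hx : x ∈ ψ.source) :
    ∀ᶠ z in 𝓝 (φ (i x)), φ.symm z ∈ range i ↔ z ∈ LinearMap.range J.toLinearMap := by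
  obtain ⟨O, hO, hOψ⟩ := hi.isOpen_iff.mp ψ.open_source
  have hφx := φ.map_source (h.mapsTo hx)
  have hOx : O ∈ 𝓝 (φ.symm (φ (i x))) :=
    hO.mem_nhds (by rw [φ.left_inv (h.mapsTo hx)]; exact hOψ.symm.subset hx)
  filter_upwards [h.eventually_exists_eq hJ hx, φ.open_target.mem_nhds hφx,
    (φ.continuousAt_symm hφx).eventually_mem hOx] with z hzJ hz hzO
  refine ⟨?_, fun hzr ↦ ?_⟩
  · rintro ⟨y, hy⟩
    have hyψ : y ∈ ψ.source := hOψ.subset (by rwa [mem_preimage, hy])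
    exact ⟨ψ y, by rw [← φ.right_inv hz, ← hy]; exact (h.eqOn hyψ).symm⟩
  · obtain ⟨y, hy, rfl⟩ := hzJ hzr
    exact ⟨y, (φ.left_inv (h.mapsTo hy)).symm⟩

end IsLinearInCharts

theorem exists_isSliceChart (hi : Manifold.IsSmoothEmbedding (𝓡 m) (𝓡 n) ∞ i) (x : M) :
    ∃ φ V, IsSliceChart (m := m) (n := n) φ V i x := by
  obtain ⟨φ, ψ, J, h, hx, hJ⟩ := exists_isLinearInCharts (hi.isImmersion.isImmersionAt x)
  have htangent (y : M) (hy : y ∈ ψ.source) :=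
    h.isTangentChartAt hy ((hi.isImmersion.contMDiff y).mdifferentiableAt (by simp))
  exact ⟨φ, LinearMap.range J.toLinearMap, h.mem_maximalAtlas,
    by rw [LinearMap.finrank_range_of_inj hJ, finrank_euclideanSpace_fin], htangent x hx,
    h.eventually_mem_range_iff hJ hi.isEmbedding.isInducing hx,
    (h.eventually_exists_eq hJ hx).mono fun z hz hzV ↦
      let ⟨y, hy, hyz⟩ := hz hzV
      ⟨y, htangent y hy, hyz⟩⟩

end Slice

section Transfer

variable {n m : ℕ} {P : Type*} [TopologicalSpace P]
  [ChartedSpace (EuclideanSpace ℝ (Fin n)) P]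
  {M : Type*} [TopologicalSpace M] [ChartedSpace (EuclideanSpace ℝ (Fin m)) M]
  {φ : OpenPartialHomeomorph P (EuclideanSpace ℝ (Fin n))}
  {V : Submodule ℝ (EuclideanSpace ℝ (Fin n))} {i : M → P}

theorem finrank_tangentSub_add_finrank_conormal (i : M → P) (y : M) :
    Module.finrank ℝ (tangentSub (m := m) (n := n) i y) +
      Module.finrank ℝ (conormal (m := m) (n := n) i y) = n := by
  have hconormal : conormal (m := m) (n := n) i y =
      (tangentSub (m := m) (n := n) i y).dualAnnihilator.map
        (LinearMap.toContinuousLinearMap :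
          (TangentSpace (𝓡 n) (i y) →ₗ[ℝ] ℝ) ≃ₗ[ℝ] Cotangent n (i y)).toLinearMap := by
    ext ξ
    constructor
    · exact fun hξ ↦ ⟨ξ.toLinearMap, (Submodule.mem_dualAnnihilator _).mpr hξ, rfl⟩
    · rintro ⟨ζ, hζ, rfl⟩ v hv
      exact (Submodule.mem_dualAnnihilator _).mp hζ v hv
  rw [hconormal, LinearEquiv.finrank_map_eq, Subspace.finrank_add_finrank_dualAnnihilator_eq]
  exact finrank_euclideanSpace_fin

theorem IsTangentChartAt.comp_mfderiv_mem_conormal_iff {y : M}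
    (h : IsTangentChartAt (m := m) φ V i y) (α : EuclideanSpace ℝ (Fin n) →L[ℝ] ℝ) :
    α ∘L mfderiv (𝓡 n) 𝓘(ℝ, EuclideanSpace ℝ (Fin n)) φ (i y) ∈
      conormal (m := m) (n := n) i y ↔ ∀ v ∈ V, α v = 0 := by
  refine ⟨fun hα v hv ↦ ?_, fun hα w hw ↦ hα _ ((h.mem_iff _).mpr ⟨w, hw, rfl⟩)⟩
  obtain ⟨w, hw, rfl⟩ := (h.mem_iff v).mp hv
  exact hα w hw

theorem IsSliceChart.apply_mem {x : M} (h : IsSliceChart (m := m) φ V i x) : φ (i x) ∈ V :=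
  h.eventually_mem_range_iff.self_of_nhds.mp
    ⟨x, (φ.left_inv h.isTangentChartAt.mem_source).symm⟩

theorem coordVec_trans {k l : ℕ} (hφ : φ ∈ IsManifold.maximalAtlas (𝓡 n) ∞ P)
    {e : OpenPartialHomeomorph (EuclideanSpace ℝ (Fin n)) (CoordSpace k l)}
    (he : ContDiffOn ℝ ∞ e.symm e.target) (a : Fin k ⊕ Fin k ⊕ Fin l) {z : CoordSpace k l}
    (hz : z ∈ (φ.trans e).target) :
    coordVec (n := n) (φ.trans e) a z =
      mfderiv 𝓘(ℝ, EuclideanSpace ℝ (Fin n)) (𝓡 n) φ.symm (e.symm z)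
        (frameVec (E := EuclideanSpace ℝ (Fin n)) e a z) := by
  rw [OpenPartialHomeomorph.trans_target] at hz
  have hez : DifferentiableAt ℝ e.symm z :=
    (he.contDiffAt (e.open_target.mem_nhds hz.1)).differentiableAt (by simp)
  have hchain := mfderiv_comp (I := 𝓘(ℝ, CoordSpace k l)) z
    ((mdifferentiable_chart hφ).symm.mdifferentiableAt hz.2) hez.mdifferentiableAt
  rw [mfderiv_eq_fderiv] at hchain
  exact DFunLike.congr_fun hchain _

theorem contMDiffOn_trans_chart {F : Type*} [NormedAddCommGroup F] [NormedSpace ℝ F]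
    (hφ : φ ∈ IsManifold.maximalAtlas (𝓡 n) ∞ P)
    {e : OpenPartialHomeomorph (EuclideanSpace ℝ (Fin n)) F} (he : ContDiffOn ℝ ∞ e e.source) :
    ContMDiffOn (𝓡 n) 𝓘(ℝ, F) ∞ (φ.trans e) (φ.trans e).source := by
  rw [OpenPartialHomeomorph.trans_source]
  exact he.contMDiffOn.comp ((contMDiffOn_of_mem_maximalAtlas hφ).mono inter_subset_left)
    inter_subset_right

theorem contMDiffOn_symm_trans_chart {F : Type*} [NormedAddCommGroup F] [NormedSpace ℝ F]
    (hφ : φ ∈ IsManifold.maximalAtlas (𝓡 n) ∞ P)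
    {e : OpenPartialHomeomorph (EuclideanSpace ℝ (Fin n)) F}
    (he : ContDiffOn ℝ ∞ e.symm e.target) :
    ContMDiffOn 𝓘(ℝ, F) (𝓡 n) ∞ (φ.trans e).symm (φ.trans e).target := by
  rw [OpenPartialHomeomorph.trans_target]
  exact (contMDiffOn_symm_of_mem_maximalAtlas hφ).comp (he.contMDiffOn.mono inter_subset_left)
    inter_subset_right

variable [IsManifold (𝓡 n) ∞ P]

namespace BivectorField

theorem toFun_eq_inChart (B : BivectorField n P)
    (hφ : φ ∈ IsManifold.maximalAtlas (𝓡 n) ∞ P) {w : EuclideanSpace ℝ (Fin n)}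
    (hw : w ∈ φ.target) (α β : Cotangent n (φ.symm w)) :
    B.toFun (φ.symm w) α β = B.inChart φ w
      (α ∘L mfderiv 𝓘(ℝ, EuclideanSpace ℝ (Fin n)) (𝓡 n) φ.symm w)
      (β ∘L mfderiv 𝓘(ℝ, EuclideanSpace ℝ (Fin n)) (𝓡 n) φ.symm w) := by
  have hinv := (mdifferentiable_chart hφ).symm_comp_deriv (φ.map_target hw)
  rw [φ.right_inv hw] at hinv
  have hcancel (γ : Cotangent n (φ.symm w)) :
      (γ ∘L mfderiv 𝓘(ℝ, EuclideanSpace ℝ (Fin n)) (𝓡 n) φ.symm w) ∘L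
        mfderiv (𝓡 n) 𝓘(ℝ, EuclideanSpace ℝ (Fin n)) φ (φ.symm w) = γ := by
    ext v
    exact congrArg γ (DFunLike.congr_fun hinv v)
  rw [B.inChart_apply]
  exact (congrArg₂ (fun α β ↦ B.toFun (φ.symm w) α β) (hcancel α) (hcancel β)).symm

theorem toFun_trans_eq_inChart (B : BivectorField n P)
    (hφ : φ ∈ IsManifold.maximalAtlas (𝓡 n) ∞ P) {k l : ℕ}
    {e : OpenPartialHomeomorph (EuclideanSpace ℝ (Fin n)) (CoordSpace k l)} {z : CoordSpace k l}
    (hz : z ∈ (φ.trans e).target) (α β : Cotangent n ((φ.trans e).symm z)) :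
    B.toFun ((φ.trans e).symm z) α β = B.inChart φ (e.symm z)
      (α ∘L mfderiv 𝓘(ℝ, EuclideanSpace ℝ (Fin n)) (𝓡 n) φ.symm (e.symm z))
      (β ∘L mfderiv 𝓘(ℝ, EuclideanSpace ℝ (Fin n)) (𝓡 n) φ.symm (e.symm z)) := by
  rw [OpenPartialHomeomorph.trans_target] at hz
  exact B.toFun_eq_inChart hφ hz.2 α β

theorem eq_zero_of_sharp_eq_zero (B : BivectorField n P) {y : M}
    (hrank : Module.finrank ℝ (B.sharpConormal (m := m) i y) =
      Module.finrank ℝ (conormal (m := m) (n := n) i y))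
    {ξ : Cotangent n (i y)} (hξ : ξ ∈ conormal (m := m) (n := n) i y)
    (hsharp : B.sharp (i y) ξ = 0) : ξ = 0 := by
  have hadd := ((B.sharp (i y)).domRestrict
    (conormal (m := m) (n := n) i y)).finrank_range_add_finrank_ker
  rw [LinearMap.range_domRestrict] at hadd
  have hker : LinearMap.ker
      ((B.sharp (i y)).domRestrict (conormal (m := m) (n := n) i y)) = ⊥ := by
    refine Submodule.finrank_eq_zero.mp ?_
    rw [sharpConormal] at hrank
    omega
  exact congrArg Subtype.val (LinearMap.ker_eq_bot'.mp hker ⟨ξ, hξ⟩ hsharp)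

theorem isCoisotropicNear_inChart (B : BivectorField n P) (hB : B.IsCoisotropic (m := m) i) {x : M}
    (hV : IsSliceChart (m := m) φ V i x) : IsCoisotropicNear (B.inChart φ) V (φ (i x)) := by
  filter_upwards [hV.eventually_exists_eq] with z hz hzV α β hα hβ
  obtain ⟨y, hy, rfl⟩ := hz hzV
  rw [B.inChart_apply, φ.left_inv hy.mem_source, ← B.apply_sharp]
  exact (hy.comp_mfderiv_mem_conormal_iff β).mpr hβ _
    (hB y (Submodule.mem_map_of_mem ((hy.comp_mfderiv_mem_conormal_iff α).mpr hα)))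

theorem sharp_eq_zero_of_inChart_eq_zero (B : BivectorField n P)
    (hφ : φ ∈ IsManifold.maximalAtlas (𝓡 n) ∞ P) {p : P} (hp : p ∈ φ.source)
    {α : EuclideanSpace ℝ (Fin n) →L[ℝ] ℝ} (h : ∀ β, B.inChart φ (φ p) α β = 0) :
    B.sharp p (α ∘L mfderiv (𝓡 n) 𝓘(ℝ, EuclideanSpace ℝ (Fin n)) φ p) = 0 := by
  let D := (mdifferentiable_chart hφ).mfderiv hp
  refine (Module.forall_dual_apply_eq_zero_iff ℝ _).mp fun f ↦ ?_
  let η : Cotangent n p := LinearMap.toContinuousLinearMap f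
  change η _ = 0
  rw [B.apply_sharp, ← h (η ∘L D.symm.toContinuousLinearMap), B.inChart_apply, φ.left_inv hp]
  congr 1
  ext v
  exact congrArg η (D.symm_apply_apply v).symm

theorem eq_zero_of_inChart_eq_zero (B : BivectorField n P)
    (hφ : φ ∈ IsManifold.maximalAtlas (𝓡 n) ∞ P) {y : M}
    (hV : IsTangentChartAt (m := m) φ V i y)
    (hrank : Module.finrank ℝ (B.sharpConormal (m := m) i y) + Module.finrank ℝ V = n)
    {α : EuclideanSpace ℝ (Fin n) →L[ℝ] ℝ} (hα : ∀ v ∈ V, α v = 0)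
    (h : ∀ β, B.inChart φ (φ (i y)) α β = 0) : α = 0 := by
  let D := (mdifferentiable_chart hφ).mfderiv hV.mem_source
  have hmap : (tangentSub (m := m) (n := n) i y).map D.toLinearEquiv.toLinearMap = V :=
    (Submodule.ext hV.mem_iff).symm
  have hfinrank : Module.finrank ℝ V = Module.finrank ℝ (tangentSub (m := m) (n := n) i y) := by
    rw [← hmap]
    exact D.toLinearEquiv.finrank_map_eq _
  have hconormal := finrank_tangentSub_add_finrank_conormal (m := m) (n := n) i y
  have hcomp := B.eq_zero_of_sharp_eq_zero (by omega)
    ((hV.comp_mfderiv_mem_conormal_iff α).mpr hα)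
    (B.sharp_eq_zero_of_inChart_eq_zero hφ hV.mem_source h)
  ext v
  obtain ⟨w, rfl⟩ := D.surjective v
  exact DFunLike.congr_fun hcomp w

end BivectorField

end Transfer

end PoissonGeom

end

open PoissonGeom in
theorem mainTheorem8_general {n m k : ℕ}
    {P : Type*} [TopologicalSpace P] [ChartedSpace (EuclideanSpace ℝ (Fin n)) P]
    [IsManifold (𝓡 n) ∞ P]
    (B : BivectorField n P) (hB : B.IsPoisson)
    {M : Type*} [TopologicalSpace M] [ChartedSpace (EuclideanSpace ℝ (Fin m)) M]
    (i : M → P) (hi : Manifold.IsSmoothEmbedding (𝓡 m) (𝓡 n) ∞ i)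
    (hcodim : m + k = n) (hcois : B.IsCoisotropic (m := m) i) (x : M)
    (hrank : Module.finrank ℝ (B.sharpConormal (m := m) i x) = k) :
    ∃ e : OpenPartialHomeomorph P (CoordSpace k (m - k)),
      i x ∈ e.source ∧
      ContMDiffOn (𝓡 n) 𝓘(ℝ, CoordSpace k (m - k)) ∞ e e.source ∧
      ContMDiffOn 𝓘(ℝ, CoordSpace k (m - k)) (𝓡 n) ∞ e.symm e.target ∧
      (∀ z ∈ e.source, z ∈ Set.range i ↔ ∀ I : Fin k, e z (ip I) = 0) ∧
      ∃ φ : Fin (m - k) → Fin (m - k) → EuclideanSpace ℝ (Fin (m - k)) → ℝ,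
        (∀ a b, ContDiff ℝ ∞ (φ a b)) ∧
        ∀ z ∈ e.target, ∀ α β : Cotangent n (e.symm z),
          B.toFun (e.symm z) α β =
            (∑ I : Fin k, wedge
              (coordVec e (iq I) z)
              (coordVec e (ip I) z) α β) +
            ∑ a : Fin (m - k), ∑ b : Fin (m - k),
              φ a b (yPart z) * wedge
                (coordVec e (iy a) z)
                (coordVec e (iy b) z) α β := by
  obtain ⟨φ, V, hφV⟩ := exists_isSliceChart hi x
  have hφ := hφV.mem_maximalAtlas
  have hx := hφV.isTangentChartAt.mem_source
  obtain ⟨e, hxe, heU, he, he', hVp, c, hc, hBc⟩ := exists_canonical_chart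
    (B.isPoissonNear_inChart hB hφ (φ.map_source hx)) (B.isCoisotropicNear_inChart hcois hφV)
    hφV.apply_mem
    (fun α ↦ B.eq_zero_of_inChart_eq_zero hφ hφV.isTangentChartAt
      (by rw [hrank, hφV.finrank_eq, add_comm, hcodim]))
    (by rw [hφV.finrank_eq, finrank_euclideanSpace_fin, hcodim]) (by rw [hφV.finrank_eq])
    hφV.eventually_mem_range_iff
  refine ⟨φ.trans e, ?_, contMDiffOn_trans_chart hφ he, contMDiffOn_symm_trans_chart hφ he',
    fun z hz ↦ ?_, c, hc, fun z hz α β ↦ ?_⟩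
  · rw [OpenPartialHomeomorph.trans_source]
    exact ⟨hx, hxe⟩
  · rw [OpenPartialHomeomorph.trans_source] at hz
    have hrange : φ.symm (φ z) ∈ Set.range i ↔ φ z ∈ V := heU hz.2
    rw [φ.left_inv hz.1] at hrange
    exact hrange.trans (hVp _ hz.2)
  · simp only [B.toFun_trans_eq_inChart hφ hz, wedge, coordVec_trans hφ he' _ hz]
    rw [OpenPartialHomeomorph.trans_target] at hz
    exact hBc z hz.1 _ _

theorem mainTheorem8 {n m k : ℕ}
    {P : Type*} [TopologicalSpace P] [ChartedSpace (EuclideanSpace ℝ (Fin n)) P]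
    [IsManifold (𝓡 n) ∞ P]
    (B : PoissonGeom.BivectorField n P) (hB : B.IsPoisson)
    {M : Type*} [TopologicalSpace M] [ChartedSpace (EuclideanSpace ℝ (Fin m)) M]
    [IsManifold (𝓡 m) ∞ M]
    (i : M → P) (hi : Manifold.IsSmoothEmbedding (𝓡 m) (𝓡 n) ∞ i)
    (hcodim : m + k = n)
    (hcois : B.IsCoisotropic (m := m) i)
    (hrank : ∀ y : M, Module.finrank ℝ (B.sharpConormal (m := m) i y) = k)
    (x : M) :
    ∃ e : OpenPartialHomeomorph P (PoissonGeom.CoordSpace k (m - k)),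
      i x ∈ e.source ∧
      ContMDiffOn (𝓡 n) 𝓘(ℝ, PoissonGeom.CoordSpace k (m - k)) ∞ e e.source ∧
      ContMDiffOn 𝓘(ℝ, PoissonGeom.CoordSpace k (m - k)) (𝓡 n) ∞ e.symm e.target ∧
      (∀ z ∈ e.source, z ∈ Set.range i ↔ ∀ I : Fin k, e z (PoissonGeom.ip I) = 0) ∧
      ∃ φ : Fin (m - k) → Fin (m - k) → EuclideanSpace ℝ (Fin (m - k)) → ℝ,
        (∀ a b, ContDiff ℝ ∞ (φ a b)) ∧
        ∀ z ∈ e.target, ∀ α β : PoissonGeom.Cotangent n (e.symm z),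
          B.toFun (e.symm z) α β =
            (∑ I : Fin k, PoissonGeom.wedge
              (PoissonGeom.coordVec e (PoissonGeom.iq I) z)
              (PoissonGeom.coordVec e (PoissonGeom.ip I) z) α β) +
            ∑ a : Fin (m - k), ∑ b : Fin (m - k),
              φ a b (PoissonGeom.yPart z) * PoissonGeom.wedge
                (PoissonGeom.coordVec e (PoissonGeom.iy a) z)
                (PoissonGeom.coordVec e (PoissonGeom.iy b) z) α β :=
  mainTheorem8_general B hB i hi hcodim hcois x (hrank x)
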